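/- Let $d\ge 1$ and $s\in(0,1)$. For a real (signed, possibly infinite) Radon measure $\nu$ on $\mathbf R^d$ that is a tempered distribution whose Fourier transform $\widehat\nu$ is a function, put $$\|\nu\|_{H^{-s}}^2=\int_{\mathbf R^d}\frac{|\widehat\nu(\xi)|^2}{(1+|\xi|^2)^{s}}\,d\xi,\qquad \|\nu\|_{\dot H^{-s}}^2=\int_{\mathbf R^d}|\widehat\nu(\xi)|^2|\xi|^{-2s}\,d\xi ,$$ and let both norms be $+\infty$ for every other Radon measure $\nu$; write $\nu\in H^{-s}(\mathbf R^d)$ if $\|\nu\|_{H^{-s}}<\infty$. For a compact set $K\subset\mathbf R^d$, a continuous function $\phi:K\to\mathbf R$ and a Radon measure $\mu$ on $K$, put $$\|\phi\|_{H^s(K)}^2=\int_K|\phi|^2\,dx+\iint_{K\times K}\frac{|\phi(x)-\phi(y)|^2}{|x-y|^{d+2s}}\,dx\,dy,\qquad \|\mu\|_{H^{-s}(K)}=\sup_{\phi\in C(K)}\frac{\int_K\phi\,d\mu}{\|\phi\|_{H^s(K)}}\in[0,\infty],$$ where a quotient with denominator $+\infty$ counts as $0$, as does $0/0$, and a quotient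 of a positive number by $0$ counts as $+\infty$. Let $\Omega\subset\mathbf R^d$ be compact. Then there exist a compact set $\Omega_1\supseteq\Omega$ and a constant $C>0$, depending only on $\Omega$ (and on $d$ and $s$), such that for every real Radon measure $\nu\in H^{-s}(\mathbf R^d)$ that is nonnegative on $\mathbf R^d\setminus\Omega$ or nonpositive on $\mathbf R^d\setminus\Omega$, $$\|\nu\|_{H^{-s}}\ \ge\ C\,\big\|\nu|_{\Omega_1}\big\|_{H^{-s}(\Omega_1)},$$ and likewise $$\|\nu\|_{\dot H^{-s}}\ \ge\ C\,\big\|\nu|_{\Omega_1}\big\|_{H^{-s}(\Omega_1)} .$$ -/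

import Mathlib

open MeasureTheory FourierTransform
open scoped ENNReal SchwartzMap

noncomputable section

namespace RieszLocalization

/-- A real (signed, possibly infinite) Radon measure on a Euclidean space, presented as the
difference `pos - neg` of two positive locally finite Borel measures. The two parts need not be
mutually singular; every notion below depends only on the difference. -/
structure SignedRadonMeasure (d : ℕ) where
  pos : Measure (EuclideanSpace ℝ (Fin d))
  neg : Measure (EuclideanSpace ℝ (Fin d))
  pos_locallyFinite : IsLocallyFiniteMeasure pos
  neg_locallyFinite : IsLocallyFiniteMeasure neg

namespace SignedRadonMeasure

variable {d : ℕ}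

attribute [instance] pos_locallyFinite neg_locallyFinite

/-- `∫ φ dν`. It is used only for `φ` that are integrable for both parts, namely functions that
are continuous on a compact set and integrated over it. -/
def integral {F : Type*} [NormedAddCommGroup F] [NormedSpace ℝ F]
    (ν : SignedRadonMeasure d) (φ : EuclideanSpace ℝ (Fin d) → F) : F :=
  (∫ x, φ x ∂ν.pos) - ∫ x, φ x ∂ν.neg

/-- The restriction `ν|_A`. -/
def restrict (ν : SignedRadonMeasure d) (A : Set (EuclideanSpace ℝ (Fin d))) :
    SignedRadonMeasure d where
  pos := ν.pos.restrict A
  neg := ν.neg.restrict A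
  pos_locallyFinite := inferInstance
  neg_locallyFinite := inferInstance

/-- `ν` is nonnegative outside of `Ω`. -/
def NonnegOutside (ν : SignedRadonMeasure d) (Ω : Set (EuclideanSpace ℝ (Fin d))) : Prop :=
  ∀ A, MeasurableSet A → A ⊆ Ωᶜ → ν.neg A ≤ ν.pos A

/-- `ν` is nonpositive outside of `Ω`. -/
def NonposOutside (ν : SignedRadonMeasure d) (Ω : Set (EuclideanSpace ℝ (Fin d))) : Prop :=
  ∀ A, MeasurableSet A → A ⊆ Ωᶜ → ν.pos A ≤ ν.neg A

/-- The tempered distribution `u` is the measure `ν`: they agree on all smooth compactly supported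
functions. -/
def IsDistribution (ν : SignedRadonMeasure d) (u : 𝓢'(EuclideanSpace ℝ (Fin d), ℂ)) : Prop :=
  ∀ φ : 𝓢(EuclideanSpace ℝ (Fin d), ℂ), HasCompactSupport φ → u φ = ν.integral φ

/-- `ν` is a tempered distribution whose (distributional) Fourier transform is the function `w`. -/
def IsFourierTransform (ν : SignedRadonMeasure d) (w : EuclideanSpace ℝ (Fin d) → ℂ) : Prop :=
  AEStronglyMeasurable w volume ∧
    ∃ u : 𝓢'(EuclideanSpace ℝ (Fin d), ℂ), ν.IsDistribution u ∧
      ∀ φ : 𝓢(EuclideanSpace ℝ (Fin d), ℂ),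
        Integrable (fun ξ => φ ξ * w ξ) volume ∧ (𝓕 u) φ = ∫ ξ, φ ξ * w ξ

/-- The norm `‖ν‖_{H^{-s}} = (∫ |ν̂(ξ)|² (1 + |ξ|²)^{-s} dξ)^{1/2}`, equal to `∞` when `ν̂` is not a
function. (`ν̂` is unique up to null sets, so the infimum is over equal values.) -/
def hNegNorm (s : ℝ) (ν : SignedRadonMeasure d) : ℝ≥0∞ :=
  ⨅ (w : EuclideanSpace ℝ (Fin d) → ℂ) (_ : ν.IsFourierTransform w),
    (∫⁻ ξ, ‖w ξ‖ₑ ^ 2 * (1 + ‖ξ‖ₑ ^ 2) ^ (-s)) ^ (1 / 2 : ℝ)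

/-- The homogeneous norm `‖ν‖_{Ḣ^{-s}} = (∫ |ν̂(ξ)|² |ξ|^{-2s} dξ)^{1/2}`, equal to `∞` when `ν̂` is
not a function. -/
def homogeneousHNegNorm (s : ℝ) (ν : SignedRadonMeasure d) : ℝ≥0∞ :=
  ⨅ (w : EuclideanSpace ℝ (Fin d) → ℂ) (_ : ν.IsFourierTransform w),
    (∫⁻ ξ, ‖w ξ‖ₑ ^ 2 * ‖ξ‖ₑ ^ (-(2 * s))) ^ (1 / 2 : ℝ)

/-- `ν ∈ H^{-s}(ℝ^d)`. -/
def MemHNeg (s : ℝ) (ν : SignedRadonMeasure d) : Prop :=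
  ν.hNegNorm s < ∞

end SignedRadonMeasure

variable {d : ℕ}

/-- The norm
`‖φ‖_{H^s(Ω)} = (∫_Ω |φ|² + ∬_{Ω × Ω} |φ(x) - φ(y)|² / |x - y|^{d + 2s} dx dy)^{1/2}`. -/
def hNormOn (s : ℝ) (Ω : Set (EuclideanSpace ℝ (Fin d)))
    (φ : EuclideanSpace ℝ (Fin d) → ℝ) : ℝ≥0∞ :=
  ((∫⁻ x in Ω, ‖φ x‖ₑ ^ 2) +
    ∫⁻ x in Ω, ∫⁻ y in Ω, ‖φ x - φ y‖ₑ ^ 2 / ‖x - y‖ₑ ^ ((d : ℝ) + 2 * s)) ^ (1 / 2 : ℝ)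

/-- The dual norm `‖μ‖_{H^{-s}(Ω)} = sup_φ ∫_Ω φ dμ / ‖φ‖_{H^s(Ω)}`, where `φ` runs over the
functions that are continuous on `Ω` (so that `∫_Ω φ dμ` makes sense for a measure `μ` that need not
be absolutely continuous). With `[0, ∞]`-valued division, `φ` of infinite `H^s(Ω)` norm contributes
`0`, and a numerator `> 0` over a vanishing norm contributes `∞`. -/
def hNegNormOn (s : ℝ) (Ω : Set (EuclideanSpace ℝ (Fin d))) (μ : SignedRadonMeasure d) : ℝ≥0∞ :=
  ⨆ (φ : EuclideanSpace ℝ (Fin d) → ℝ) (_ : ContinuousOn φ Ω),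
    ENNReal.ofReal ((μ.restrict Ω).integral φ) / hNormOn s Ω φ

end RieszLocalization

end

noncomputable section

namespace RieszLocalization

variable {d : ℕ}

-- Take `Ω` inside the ball of radius `r` and let `Ω₁ = B` be the closed ball of radius `r + 1`. The
-- sign of `ν` off `Ω` is used through a one-sided extension of test functions. Given `φ` continuous
-- on `B`, there is a continuous compactly supported `F` with `F = φ` on `Ω`, `F ≥ φ` on `B`, `F ≥
-- 0` off `B`, and `‖F‖_{H^s(ℝ^d)} ≤ C ‖φ‖_{H^s(B)}`. If `ν ≥ 0` off `Ω`, then `∫_B φ dν ≤ ∫ F dν ≤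
-- C' ‖ν‖_{H^{-s}} ‖φ‖_{H^s(B)}`; if `ν ≤ 0` off `Ω`, the same argument runs with `-φ` and the two
-- parts of `ν` exchanged.
--
-- The extension (`exists_sobolevSq_dominatingExtension_le`) first composes `φ` with the fold of
-- `ℝ^d` onto `B` by inversion, which is 1-Lipschitz and distorts volume boundedly on bounded sets.
-- With `Φ` the result and `χ_a` the cutoffs, `F = χ_r Φ + (χ_{r+1} - χ_r) |Φ|`. Passing to `|Φ|`
-- does not increase Gagliardo differences.
--
-- The duality bound (`exists_enorm_integral_le`) is Plancherel and Cauchy–Schwarz for Schwartz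
-- functions, then mollification, since `F` is merely continuous. The homogeneous bound follows
-- because its weight is pointwise larger.

/-- The square of the Gagliardo seminorm of order `s` on `ℝ^d`. -/
def gagliardoSq {F : Type*} [NormedAddCommGroup F] (s : ℝ) (f : EuclideanSpace ℝ (Fin d) → F) :
    ℝ≥0∞ :=
  ∫⁻ x, ∫⁻ y, ‖f x - f y‖ₑ ^ 2 / ‖x - y‖ₑ ^ ((d : ℝ) + 2 * s)

/-- The square of the `H^s` norm on `ℝ^d`. -/
def sobolevSq {F : Type*} [NormedAddCommGroup F] (s : ℝ) (f : EuclideanSpace ℝ (Fin d) → F) :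
    ℝ≥0∞ :=
  (∫⁻ x, ‖f x‖ₑ ^ 2) + gagliardoSq s f

-- The Gagliardo seminorm on the Fourier side.

lemma measurable_gagliardo_integrand {F : Type*} [NormedAddCommGroup F] (p : ℝ)
    {f : EuclideanSpace ℝ (Fin d) → F} (hf : Continuous f) :
    Measurable fun z : EuclideanSpace ℝ (Fin d) × EuclideanSpace ℝ (Fin d) =>
      ‖f z.1 - f z.2‖ₑ ^ 2 / ‖z.1 - z.2‖ₑ ^ p := by
  have h1 : Measurable fun z : EuclideanSpace ℝ (Fin d) × EuclideanSpace ℝ (Fin d) =>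
      ‖f z.1 - f z.2‖ₑ :=
    ((hf.comp continuous_fst).sub (hf.comp continuous_snd)).enorm.measurable
  have h2 : Measurable fun z : EuclideanSpace ℝ (Fin d) × EuclideanSpace ℝ (Fin d) =>
      ‖z.1 - z.2‖ₑ := (continuous_fst.sub continuous_snd).enorm.measurable
  exact (h1.pow_const 2).div (h2.pow_const p)

lemma lintegral_enorm_sq_fourier (f : 𝓢(EuclideanSpace ℝ (Fin d), ℂ)) :
    ∫⁻ ξ, ‖𝓕 f ξ‖ₑ ^ 2 = ∫⁻ x, ‖f x‖ₑ ^ 2 := by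
  have key : ∀ g : 𝓢(EuclideanSpace ℝ (Fin d), ℂ),
      ∫⁻ x, ‖g x‖ₑ ^ 2 = ENNReal.ofReal (∫ x, ‖g x‖ ^ 2) := by
    intro g
    have hi : Integrable (fun x => ‖g x‖ ^ 2) := (g.memLp 2 volume).integrable_norm_pow (by simp)
    rw [ofReal_integral_eq_lintegral_ofReal hi (Filter.Eventually.of_forall fun x => by positivity)]
    refine lintegral_congr fun x => ?_
    rw [ENNReal.ofReal_pow (norm_nonneg _), ofReal_norm]
  rw [key, key, SchwartzMap.integral_norm_sq_fourier]

/-- Translation becomes multiplication by a character, so this is Plancherel for the difference. -/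
lemma lintegral_enorm_sq_translate_sub (f : 𝓢(EuclideanSpace ℝ (Fin d), ℂ))
    (h : EuclideanSpace ℝ (Fin d)) :
    ∫⁻ x, ‖f (x + h) - f x‖ₑ ^ 2 =
      ∫⁻ ξ, ‖((Real.fourierChar (inner ℝ h ξ) : Circle) : ℂ) - 1‖ₑ ^ 2 * ‖𝓕 f ξ‖ₑ ^ 2 := by
  have htg : (fun x : EuclideanSpace ℝ (Fin d) => x + h).HasTemperateGrowth :=
    Function.HasTemperateGrowth.id'.add (.const h)
  have hal : AntilipschitzWith 1 (fun x : EuclideanSpace ℝ (Fin d) => x + h) :=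
    (IsometryEquiv.addRight h).isometry.antilipschitz
  set g : 𝓢(EuclideanSpace ℝ (Fin d), ℂ) := SchwartzMap.compCLMOfAntilipschitz ℂ htg hal f with hg
  have hgx : ∀ x, g x = f (x + h) := fun x => rfl
  have h1 : ∀ x, f (x + h) - f x = (g - f) x := fun x => by simp [hgx]
  simp_rw [h1]
  rw [← lintegral_enorm_sq_fourier]
  refine lintegral_congr fun ξ => ?_
  have h2 : 𝓕 g ξ = ((Real.fourierChar (inner ℝ h ξ) : Circle) : ℂ) * 𝓕 f ξ := by
    have := congrFun (VectorFourier.fourierIntegral_comp_add_right Real.fourierChar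
      (volume : Measure (EuclideanSpace ℝ (Fin d))) (innerₗ _) (f : _ → ℂ) h) ξ
    rw [SchwartzMap.fourier_coe, SchwartzMap.fourier_coe]
    exact this
  have h3 : 𝓕 (g - f) ξ = (((Real.fourierChar (inner ℝ h ξ) : Circle) : ℂ) - 1) * 𝓕 f ξ := by
    rw [← FourierTransform.fourierCLM_apply (R := ℂ), map_sub, FourierTransform.fourierCLM_apply,
      FourierTransform.fourierCLM_apply, sub_apply, h2]
    ring
  rw [h3, enorm_mul, mul_pow]

lemma one_le_norm_fourierChar_sub_one {t : ℝ} (ht : |t - 1 / 2| ≤ 1 / 4) :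
    1 ≤ ‖((Real.fourierChar t : Circle) : ℂ) - 1‖ := by
  have h : ((((Real.fourierChar t : Circle) : ℂ)) - 1).re = Real.cos (2 * Real.pi * t) - 1 := by
    rw [Real.fourierChar_apply, Complex.sub_re, Complex.one_re]
    congr 1
    rw [← Complex.exp_ofReal_mul_I_re]
  have hc : Real.cos (2 * Real.pi * t) ≤ 0 := by
    rw [abs_le] at ht
    apply Real.cos_nonpos_of_pi_div_two_le_of_le <;> nlinarith [Real.pi_pos]
  calc (1 : ℝ) ≤ |Real.cos (2 * Real.pi * t) - 1| := by rw [abs_of_nonpos] <;> linarith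
    _ ≤ _ := by rw [← h]; exact Complex.abs_re_le_norm _

/-- Only a ball of `h` of size comparable to `1 / ‖ξ‖` is needed: around `ξ / (2 ‖ξ‖²)` the phase
`⟨h, ξ⟩` stays near `1/2`, where the character is far from `1`. The kernel there is at least `‖ξ‖ ^
(d + 2s)` and the volume is of order `‖ξ‖ ^ (-d)`. -/
lemma exists_enorm_rpow_le_lintegral (hd : 1 ≤ d) {s : ℝ} (hs : 0 < s) :
    ∃ C : ℝ≥0∞, C ≠ ∞ ∧ ∀ ξ : EuclideanSpace ℝ (Fin d), ‖ξ‖ₑ ^ (2 * s) ≤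
      C * ∫⁻ h : EuclideanSpace ℝ (Fin d),
        ‖((Real.fourierChar (inner ℝ h ξ) : Circle) : ℂ) - 1‖ₑ ^ 2 / ‖h‖ₑ ^ ((d : ℝ) + 2 * s) := by
  set v := volume (Metric.ball (0 : EuclideanSpace ℝ (Fin d)) 1) with hv
  have hv0 : v ≠ 0 := (Metric.measure_ball_pos _ _ one_pos).ne'
  have hvt : v ≠ ∞ := measure_ball_lt_top.ne
  refine ⟨8 ^ d * v⁻¹, ENNReal.mul_ne_top (by simp) (by simp [hv0]), fun ξ => ?_⟩
  rcases eq_or_ne ξ 0 with rfl | hξ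
  · simp [ENNReal.zero_rpow_of_pos (show 0 < 2 * s by positivity)]
  have hn : 0 < ‖ξ‖ := norm_pos_iff.2 hξ
  set c : EuclideanSpace ℝ (Fin d) := (1 / (2 * ‖ξ‖ ^ 2)) • ξ with hc
  set r : ℝ := 1 / (8 * ‖ξ‖) with hr
  have hr0 : 0 < r := by positivity
  have hcn : ‖c‖ = 1 / (2 * ‖ξ‖) := by
    rw [hc, norm_smul, Real.norm_of_nonneg (by positivity)]; field_simp
  have hB : ∀ h ∈ Metric.ball c r, ENNReal.ofReal (‖ξ‖ ^ ((d : ℝ) + 2 * s)) ≤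
      ‖((Real.fourierChar (inner ℝ h ξ) : Circle) : ℂ) - 1‖ₑ ^ 2 / ‖h‖ₑ ^ ((d : ℝ) + 2 * s) := by
    intro h hh
    rw [Metric.mem_ball, dist_eq_norm] at hh
    have hhn : ‖h‖ ≤ ‖ξ‖⁻¹ := by
      have : ‖h‖ ≤ ‖h - c‖ + ‖c‖ := by simpa using norm_add_le (h - c) c
      have h5 : r + 1 / (2 * ‖ξ‖) ≤ ‖ξ‖⁻¹ := by
        rw [hr, inv_eq_one_div, div_add_div _ _ (by positivity) (by positivity),
          div_le_div_iff₀ (by positivity) hn]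
        nlinarith
      linarith
    have hin : |inner ℝ h ξ - 1 / 2| ≤ 1 / 4 := by
      have e1 : inner ℝ c ξ = (1 / 2 : ℝ) := by
        rw [hc, real_inner_smul_left, real_inner_self_eq_norm_sq]; field_simp
      rw [← e1, ← inner_sub_left]
      refine (abs_real_inner_le_norm _ _).trans ?_
      calc ‖h - c‖ * ‖ξ‖ ≤ r * ‖ξ‖ := by gcongr
        _ = 1 / 8 := by rw [hr]; field_simp
        _ ≤ 1 / 4 := by norm_num
    have h1 := one_le_norm_fourierChar_sub_one hin
    have hp : 0 < (d : ℝ) + 2 * s := by positivity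
    calc ENNReal.ofReal (‖ξ‖ ^ ((d : ℝ) + 2 * s))
        = (ENNReal.ofReal (‖ξ‖⁻¹ ^ ((d : ℝ) + 2 * s)))⁻¹ := by
          rw [Real.inv_rpow hn.le, ENNReal.ofReal_inv_of_pos (by positivity), inv_inv]
      _ ≤ (‖h‖ₑ ^ ((d : ℝ) + 2 * s))⁻¹ := by
          rw [ENNReal.inv_le_inv, ← ofReal_norm, ENNReal.ofReal_rpow_of_nonneg (norm_nonneg _) hp.le]
          gcongr
      _ ≤ _ := by
          rw [div_eq_mul_inv]
          apply le_mul_of_one_le_left (by simp)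
          apply one_le_pow₀
          rw [← ofReal_norm]
          simpa using ENNReal.ofReal_le_ofReal h1
  have hlow : ENNReal.ofReal (‖ξ‖ ^ ((d : ℝ) + 2 * s)) * volume (Metric.ball c r) ≤
      ∫⁻ h : EuclideanSpace ℝ (Fin d),
        ‖((Real.fourierChar (inner ℝ h ξ) : Circle) : ℂ) - 1‖ₑ ^ 2 / ‖h‖ₑ ^ ((d : ℝ) + 2 * s) := by
    rw [← setLIntegral_const]
    exact (setLIntegral_mono' Metric.isOpen_ball.measurableSet hB).trans
      (setLIntegral_le_lintegral _ _)
  refine le_trans ?_ (mul_le_mul_right hlow _)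
  have hvol : volume (Metric.ball c r) = ENNReal.ofReal (r ^ d) * v := by
    rw [Measure.addHaar_ball_of_pos _ _ hr0, finrank_euclideanSpace_fin]
  rw [hvol, ← ofReal_norm, ENNReal.ofReal_rpow_of_pos hn]
  have h8 : (8 : ℝ≥0∞) ^ d = ENNReal.ofReal (8 ^ d) := by
    rw [ENNReal.ofReal_pow (by norm_num)]; norm_num
  have e : (8 : ℝ≥0∞) ^ d * v⁻¹ * (ENNReal.ofReal (‖ξ‖ ^ ((d : ℝ) + 2 * s)) *
      (ENNReal.ofReal (r ^ d) * v)) = ENNReal.ofReal (8 ^ d) *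
        ENNReal.ofReal (‖ξ‖ ^ ((d : ℝ) + 2 * s)) * ENNReal.ofReal (r ^ d) * (v⁻¹ * v) := by
    rw [h8]; ring
  rw [e, ENNReal.inv_mul_cancel hv0 hvt, mul_one, ← ENNReal.ofReal_mul (by positivity),
    ← ENNReal.ofReal_mul (by positivity)]
  apply ENNReal.ofReal_le_ofReal
  rw [Real.rpow_add hn, Real.rpow_natCast, hr]
  apply le_of_eq
  rw [one_div, inv_pow, mul_pow]
  field_simp

/-- Substitute `y = x + h`, apply Plancherel in `x` for each fixed `h`, and exchange the integrals
by Tonelli. -/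
lemma gagliardoSq_eq_lintegral_fourier {s : ℝ} (f : 𝓢(EuclideanSpace ℝ (Fin d), ℂ)) :
    gagliardoSq s f = ∫⁻ ξ, ‖𝓕 f ξ‖ₑ ^ 2 * ∫⁻ h : EuclideanSpace ℝ (Fin d),
      ‖((Real.fourierChar (inner ℝ h ξ) : Circle) : ℂ) - 1‖ₑ ^ 2 / ‖h‖ₑ ^ ((d : ℝ) + 2 * s) := by
  set p := (d : ℝ) + 2 * s
  have hm1 : Measurable fun z : EuclideanSpace ℝ (Fin d) × EuclideanSpace ℝ (Fin d) =>
      ‖f (z.1 + z.2) - f z.1‖ₑ ^ 2 / ‖z.2‖ₑ ^ p := by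
    have h1 : Measurable fun z : EuclideanSpace ℝ (Fin d) × EuclideanSpace ℝ (Fin d) =>
        ‖f (z.1 + z.2) - f z.1‖ₑ :=
      ((f.continuous.comp (continuous_fst.add continuous_snd)).sub
        (f.continuous.comp continuous_fst)).enorm.measurable
    exact (h1.pow_const 2).div (measurable_snd.enorm.pow_const p)
  have hmc : Measurable fun z : EuclideanSpace ℝ (Fin d) × EuclideanSpace ℝ (Fin d) =>
      ‖((Real.fourierChar (inner ℝ z.1 z.2) : Circle) : ℂ) - 1‖ₑ := by
    apply Continuous.measurable
    apply Continuous.enorm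
    apply Continuous.sub _ continuous_const
    exact continuous_subtype_val.comp (Real.continuous_fourierChar.comp continuous_inner)
  have hm2 : Measurable fun z : EuclideanSpace ℝ (Fin d) × EuclideanSpace ℝ (Fin d) =>
      ‖((Real.fourierChar (inner ℝ z.1 z.2) : Circle) : ℂ) - 1‖ₑ ^ 2 * ‖𝓕 f z.2‖ₑ ^ 2 /
        ‖z.1‖ₑ ^ p := by
    refine Measurable.div ((hmc.pow_const 2).mul ?_) (measurable_fst.enorm.pow_const p)
    exact (((𝓕 f).continuous.comp continuous_snd).enorm.measurable).pow_const 2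
  calc gagliardoSq s f
      = ∫⁻ x, ∫⁻ h, ‖f (x + h) - f x‖ₑ ^ 2 / ‖h‖ₑ ^ p := by
        refine lintegral_congr fun x => ?_
        rw [← lintegral_add_left_eq_self _ x]
        refine lintegral_congr fun h => ?_
        rw [← enorm_neg (f x - _), neg_sub, ← enorm_neg (x - _)]
        simp [p]
    _ = ∫⁻ h, ∫⁻ x, ‖f (x + h) - f x‖ₑ ^ 2 / ‖h‖ₑ ^ p :=
        lintegral_lintegral_swap hm1.aemeasurable
    _ = ∫⁻ h : EuclideanSpace ℝ (Fin d), ∫⁻ ξ,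
          ‖((Real.fourierChar (inner ℝ h ξ) : Circle) : ℂ) - 1‖ₑ ^ 2 * ‖𝓕 f ξ‖ₑ ^ 2 /
            ‖h‖ₑ ^ p := by
        refine lintegral_congr fun h => ?_
        simp_rw [div_eq_mul_inv]
        rw [lintegral_mul_const, lintegral_mul_const, lintegral_enorm_sq_translate_sub]
        · exact (((hmc.comp measurable_prodMk_left).pow_const 2).mul
            ((𝓕 f).continuous.enorm.measurable.pow_const 2))
        · exact (((f.continuous.comp (continuous_add_const h)).sub
            f.continuous).enorm.measurable).pow_const 2
    _ = ∫⁻ ξ, ∫⁻ h : EuclideanSpace ℝ (Fin d),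
          ‖((Real.fourierChar (inner ℝ h ξ) : Circle) : ℂ) - 1‖ₑ ^ 2 * ‖𝓕 f ξ‖ₑ ^ 2 /
            ‖h‖ₑ ^ p := lintegral_lintegral_swap hm2.aemeasurable
    _ = _ := by
        refine lintegral_congr fun ξ => ?_
        rw [← lintegral_const_mul]
        · refine lintegral_congr fun h => ?_
          rw [mul_comm, mul_div_assoc]
        · exact ((hmc.comp measurable_prodMk_right).pow_const 2).div
            (measurable_id.enorm.pow_const p)

/-- The Fourier-side `H^s` norm is controlled by the Gagliardo norm. -/
lemma exists_lintegral_fourierInv_le (hd : 1 ≤ d) {s : ℝ} (hs : 0 < s) (hs1 : s < 1) :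
    ∃ C : ℝ≥0∞, C ≠ ∞ ∧ ∀ f : 𝓢(EuclideanSpace ℝ (Fin d), ℂ),
      ∫⁻ ξ, ‖𝓕⁻ f ξ‖ₑ ^ 2 * (1 + ‖ξ‖ₑ ^ 2) ^ s ≤ C * sobolevSq s f := by
  obtain ⟨C, hC, h⟩ := exists_enorm_rpow_le_lintegral hd hs
  refine ⟨1 + C, by simp [hC], fun f => ?_⟩
  have hF : Measurable fun ξ => ‖𝓕 f ξ‖ₑ ^ 2 := (𝓕 f).continuous.enorm.measurable.pow_const 2
  calc ∫⁻ ξ, ‖𝓕⁻ f ξ‖ₑ ^ 2 * (1 + ‖ξ‖ₑ ^ 2) ^ s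
      = ∫⁻ ξ, ‖𝓕 f ξ‖ₑ ^ 2 * (1 + ‖ξ‖ₑ ^ 2) ^ s := by
        rw [← lintegral_neg_eq_self]
        refine lintegral_congr fun ξ => ?_
        rw [enorm_neg, SchwartzMap.fourierInv_coe, SchwartzMap.fourier_coe,
          Real.fourierInv_eq_fourier_neg, neg_neg]
    _ ≤ ∫⁻ ξ, (‖𝓕 f ξ‖ₑ ^ 2 + ‖𝓕 f ξ‖ₑ ^ 2 * (C * ∫⁻ h : EuclideanSpace ℝ (Fin d),
          ‖((Real.fourierChar (inner ℝ h ξ) : Circle) : ℂ) - 1‖ₑ ^ 2 /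
            ‖h‖ₑ ^ ((d : ℝ) + 2 * s))) := by
        refine lintegral_mono fun ξ => ?_
        rw [← mul_one_add]
        gcongr
        -- Subadditivity of `t ↦ t ^ s`, valid since `s ≤ 1`.
        refine (ENNReal.rpow_add_le_add_rpow _ _ hs.le hs1.le).trans ?_
        rw [ENNReal.one_rpow]
        gcongr
        refine le_trans (le_of_eq ?_) (h ξ)
        rw [← ENNReal.rpow_natCast, ← ENNReal.rpow_mul]; norm_num
    _ = (∫⁻ x, ‖f x‖ₑ ^ 2) + C * gagliardoSq s f := by
        rw [lintegral_add_left hF, lintegral_enorm_sq_fourier, gagliardoSq_eq_lintegral_fourier,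
          ← lintegral_const_mul' _ _ hC]
        congr 1
        refine lintegral_congr fun ξ => ?_
        ring
    _ ≤ _ := by
        rw [sobolevSq, add_mul, mul_add, mul_add, one_mul, one_mul]
        gcongr
        · exact le_add_right le_rfl
        · exact le_add_left le_rfl

-- Duality between measures and continuous test functions.

lemma lintegral_mul_le_sqrt_mul_sqrt {α : Type*} [MeasurableSpace α] (μ : Measure α)
    {f g : α → ℝ≥0∞} (hf : AEMeasurable f μ) (hg : AEMeasurable g μ) :
    ∫⁻ a, f a * g a ∂μ ≤
      (∫⁻ a, f a ^ 2 ∂μ) ^ (1 / 2 : ℝ) * (∫⁻ a, g a ^ 2 ∂μ) ^ (1 / 2 : ℝ) := by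
  have h := ENNReal.lintegral_mul_le_Lp_mul_Lq μ (Real.HolderConjugate.two_two) hf hg
  simpa using h

lemma lintegral_sq_le_of_isProbabilityMeasure {α : Type*} [MeasurableSpace α] (μ : Measure α)
    [IsProbabilityMeasure μ] {f : α → ℝ≥0∞} (hf : AEMeasurable f μ) :
    (∫⁻ a, f a ∂μ) ^ 2 ≤ ∫⁻ a, f a ^ 2 ∂μ := by
  have h := lintegral_mul_le_sqrt_mul_sqrt μ hf (aemeasurable_const (b := (1 : ℝ≥0∞)))
  simp only [mul_one, one_pow, lintegral_const, measure_univ, ENNReal.one_rpow] at h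
  calc (∫⁻ a, f a ∂μ) ^ 2 ≤ ((∫⁻ a, f a ^ 2 ∂μ) ^ (1 / 2 : ℝ)) ^ 2 := by gcongr
    _ = _ := by rw [← ENNReal.rpow_natCast, ← ENNReal.rpow_mul]; norm_num

/-- Pairing of a measure in `H^{-s}` with a test function, in terms of the Fourier transforms. -/
lemma enorm_integral_le_of_isFourierTransform (s : ℝ) {ν : SignedRadonMeasure d}
    {w : EuclideanSpace ℝ (Fin d) → ℂ} (hw : ν.IsFourierTransform w)
    (f : 𝓢(EuclideanSpace ℝ (Fin d), ℂ)) (hf : HasCompactSupport f) :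
    ‖ν.integral f‖ₑ ≤ (∫⁻ ξ, ‖𝓕⁻ f ξ‖ₑ ^ 2 * (1 + ‖ξ‖ₑ ^ 2) ^ s) ^ (1 / 2 : ℝ) *
      (∫⁻ ξ, ‖w ξ‖ₑ ^ 2 * (1 + ‖ξ‖ₑ ^ 2) ^ (-s)) ^ (1 / 2 : ℝ) := by
  obtain ⟨hwm, u, hu, hint⟩ := hw
  have h1 : ν.integral f = ∫ ξ, 𝓕⁻ f ξ * w ξ := by
    rw [← (hint (𝓕⁻ f)).2, TemperedDistribution.fourier_apply, FourierTransform.fourier_fourierInv_eq,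
      hu f hf]
  have hmw : ∀ p : ℝ, Measurable fun ξ : EuclideanSpace ℝ (Fin d) => (1 + ‖ξ‖ₑ ^ 2) ^ p :=
    fun p => (measurable_const.add (measurable_id.enorm.pow_const 2)).pow_const p
  have hb0 : ∀ ξ : EuclideanSpace ℝ (Fin d), (1 + ‖ξ‖ₑ ^ 2 : ℝ≥0∞) ≠ 0 := fun ξ => by simp
  have hbt : ∀ ξ : EuclideanSpace ℝ (Fin d), (1 + ‖ξ‖ₑ ^ 2 : ℝ≥0∞) ≠ ∞ := fun ξ => by
    simp [ENNReal.pow_eq_top_iff]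
  rw [h1]
  calc ‖∫ ξ, 𝓕⁻ f ξ * w ξ‖ₑ ≤ ∫⁻ ξ, ‖𝓕⁻ f ξ * w ξ‖ₑ := enorm_integral_le_lintegral_enorm _
    -- Insert the weight to the powers `s / 2` and `-s / 2` before Cauchy–Schwarz; it is neither `0`
    -- nor `∞`, so the powers cancel.
    _ = ∫⁻ ξ, (‖𝓕⁻ f ξ‖ₑ * (1 + ‖ξ‖ₑ ^ 2) ^ (s / 2)) *
          (‖w ξ‖ₑ * (1 + ‖ξ‖ₑ ^ 2) ^ (-s / 2)) := by
        refine lintegral_congr fun ξ => ?_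
        rw [mul_mul_mul_comm, ← ENNReal.rpow_add _ _ (hb0 ξ) (hbt ξ), enorm_mul]
        ring_nf
        simp
    _ ≤ _ := lintegral_mul_le_sqrt_mul_sqrt _
          ((𝓕⁻ f).continuous.enorm.measurable.mul (hmw _)).aemeasurable
          (hwm.enorm.mul (hmw _).aemeasurable)
    _ = _ := by
        congr 2 <;>
        · refine lintegral_congr fun ξ => ?_
          rw [mul_pow, ← ENNReal.rpow_natCast ((1 + ‖ξ‖ₑ ^ 2) ^ _), ← ENNReal.rpow_mul]
          congr 2
          push_cast
          ring

/-- Averaging translates of a function does not increase its `H^s` norm. -/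
lemma sobolevSq_average_le (s : ℝ) (m : Measure (EuclideanSpace ℝ (Fin d)))
    [IsProbabilityMeasure m] {F : EuclideanSpace ℝ (Fin d) → ℝ} (hF : Continuous F)
    (hFc : HasCompactSupport F) :
    sobolevSq s (fun x => ∫ t, F (x - t) ∂m) ≤ sobolevSq s F := by
  set p := (d : ℝ) + 2 * s with hp
  obtain ⟨B, hB⟩ := hF.bounded_above_of_compact_support hFc
  have hint : ∀ x, Integrable (fun t => F (x - t)) m := fun x =>
    Integrable.of_bound (hF.comp (continuous_const.sub continuous_id)).aestronglyMeasurable B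
      (Filter.Eventually.of_forall fun t => hB _)
  unfold sobolevSq gagliardoSq
  refine add_le_add ?_ ?_
  · calc ∫⁻ x, ‖∫ t, F (x - t) ∂m‖ₑ ^ 2
        ≤ ∫⁻ x, ∫⁻ t, ‖F (x - t)‖ₑ ^ 2 ∂m := by
          refine lintegral_mono fun x => ?_
          refine le_trans ?_ (lintegral_sq_le_of_isProbabilityMeasure m
            (hint x).aestronglyMeasurable.enorm)
          gcongr
          exact enorm_integral_le_lintegral_enorm _
      _ = ∫⁻ t, (∫⁻ x, ‖F (x - t)‖ₑ ^ 2) ∂m := by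
          refine lintegral_lintegral_swap ?_
          exact ((hF.comp (continuous_fst.sub continuous_snd)).enorm.measurable.pow_const
            2).aemeasurable
      _ = ∫⁻ t, (∫⁻ x, ‖F x‖ₑ ^ 2) ∂m := by
          refine lintegral_congr fun t => ?_
          exact lintegral_sub_right_eq_self (fun x => ‖F x‖ₑ ^ 2) t
      _ = _ := by simp
  · have hm : Measurable fun z : (EuclideanSpace ℝ (Fin d) × EuclideanSpace ℝ (Fin d)) ×
        EuclideanSpace ℝ (Fin d) =>
        ‖F (z.1.1 - z.1.2) - F (z.2 - z.1.2)‖ₑ ^ 2 / ‖z.1.1 - z.2‖ₑ ^ p := by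
      have h1 : Measurable fun z : (EuclideanSpace ℝ (Fin d) × EuclideanSpace ℝ (Fin d)) ×
          EuclideanSpace ℝ (Fin d) => ‖F (z.1.1 - z.1.2) - F (z.2 - z.1.2)‖ₑ := by
        apply Continuous.measurable
        fun_prop
      have h2 : Measurable fun z : (EuclideanSpace ℝ (Fin d) × EuclideanSpace ℝ (Fin d)) ×
          EuclideanSpace ℝ (Fin d) => ‖z.1.1 - z.2‖ₑ := by
        apply Continuous.measurable
        fun_prop
      exact (h1.pow_const 2).div (h2.pow_const p)
    calc ∫⁻ x, ∫⁻ y, ‖(∫ t, F (x - t) ∂m) - ∫ t, F (y - t) ∂m‖ₑ ^ 2 / ‖x - y‖ₑ ^ p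
        ≤ ∫⁻ x, ∫⁻ y, ∫⁻ t, ‖F (x - t) - F (y - t)‖ₑ ^ 2 / ‖x - y‖ₑ ^ p ∂m := by
          refine lintegral_mono fun x => lintegral_mono fun y => ?_
          rw [← integral_sub (hint x) (hint y)]
          have hi : AEMeasurable (fun t => ‖F (x - t) - F (y - t)‖ₑ) m :=
            ((hint x).sub (hint y)).aestronglyMeasurable.enorm
          simp_rw [div_eq_mul_inv]
          rw [lintegral_mul_const'' _ (hi.pow_const 2)]
          gcongr
          refine le_trans ?_ (lintegral_sq_le_of_isProbabilityMeasure m hi)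
          gcongr
          exact enorm_integral_le_lintegral_enorm _
      _ = ∫⁻ x, ∫⁻ t, (∫⁻ y, ‖F (x - t) - F (y - t)‖ₑ ^ 2 / ‖x - y‖ₑ ^ p) ∂m := by
          refine lintegral_congr fun x => ?_
          have hz : Measurable fun z : EuclideanSpace ℝ (Fin d) × EuclideanSpace ℝ (Fin d) =>
              ((x, z.2), z.1) := (measurable_const.prodMk measurable_snd).prodMk measurable_fst
          have hmx := hm.comp hz
          simp only [Function.comp_def] at hmx
          exact lintegral_lintegral_swap hmx.aemeasurable
      _ = ∫⁻ t, (∫⁻ x, ∫⁻ y, ‖F (x - t) - F (y - t)‖ₑ ^ 2 / ‖x - y‖ₑ ^ p) ∂m := by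
          refine lintegral_lintegral_swap ?_
          exact hm.lintegral_prod_right'.aemeasurable
      _ = ∫⁻ t, (∫⁻ x, ∫⁻ y, ‖F x - F y‖ₑ ^ 2 / ‖x - y‖ₑ ^ p) ∂m := by
          refine lintegral_congr fun t => ?_
          refine Eq.trans ?_ (lintegral_sub_right_eq_self
            (fun x => ∫⁻ y, ‖F x - F y‖ₑ ^ 2 / ‖x - y‖ₑ ^ p) t)
          refine lintegral_congr fun x => ?_
          refine Eq.trans ?_ (lintegral_sub_right_eq_self
            (fun y => ‖F (x - t) - F y‖ₑ ^ 2 / ‖x - t - y‖ₑ ^ p) t)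
          refine lintegral_congr fun y => ?_
          rw [sub_sub_sub_cancel_right]
      _ = _ := by simp [p]

/-- The probability measure whose density is a normalized bump function. -/
def bumpMeasure (φ : ContDiffBump (0 : EuclideanSpace ℝ (Fin d))) :
    Measure (EuclideanSpace ℝ (Fin d)) :=
  volume.withDensity fun t => ENNReal.ofReal (φ.normed volume t)

instance (φ : ContDiffBump (0 : EuclideanSpace ℝ (Fin d))) :
    IsProbabilityMeasure (bumpMeasure φ) := by
  constructor
  rw [bumpMeasure, withDensity_apply _ MeasurableSet.univ, setLIntegral_univ,
    ← ofReal_integral_eq_lintegral_ofReal φ.integrable_normed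
      (Filter.Eventually.of_forall φ.nonneg_normed), φ.integral_normed, ENNReal.ofReal_one]

open ContinuousLinearMap in
-- Seen as an average of translates over a probability measure, the mollification falls under
-- `sobolevSq_average_le`.
lemma normed_convolution_eq_average (φ : ContDiffBump (0 : EuclideanSpace ℝ (Fin d)))
    (F : EuclideanSpace ℝ (Fin d) → ℝ) (x : EuclideanSpace ℝ (Fin d)) :
    convolution (φ.normed volume) F (lsmul ℝ ℝ) volume x = ∫ t, F (x - t) ∂bumpMeasure φ := by
  rw [bumpMeasure, integral_withDensity_eq_integral_toReal_smul
    φ.continuous_normed.measurable.ennreal_ofReal (by simp), convolution_def]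
  refine integral_congr_ae (Filter.Eventually.of_forall fun t => ?_)
  simp [ENNReal.toReal_ofReal (φ.nonneg_normed t)]

open ContinuousLinearMap Pointwise in
/-- Duality between `H^{-s}` measures and continuous compactly supported `H^s` functions. -/
theorem exists_enorm_integral_le (hd : 1 ≤ d) {s : ℝ} (hs : 0 < s) (hs1 : s < 1) :
    ∃ C : ℝ≥0∞, C ≠ ∞ ∧ ∀ (ν : SignedRadonMeasure d) (w : EuclideanSpace ℝ (Fin d) → ℂ),
      ν.IsFourierTransform w → ∀ F : EuclideanSpace ℝ (Fin d) → ℝ, Continuous F →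
        HasCompactSupport F → ‖ν.integral F‖ₑ ≤ (C * sobolevSq s F) ^ (1 / 2 : ℝ) *
          (∫⁻ ξ, ‖w ξ‖ₑ ^ 2 * (1 + ‖ξ‖ₑ ^ 2) ^ (-s)) ^ (1 / 2 : ℝ) := by
  obtain ⟨C, hC, hfour⟩ := exists_lintegral_fourierInv_le hd hs hs1
  refine ⟨C, hC, fun ν w hw F hF hFc => ?_⟩
  -- The radii tend to `0` but never exceed `1`, so all the mollified functions are supported in one
  -- compact set, on which both parts of `ν` are finite.
  let φ : ℕ → ContDiffBump (0 : EuclideanSpace ℝ (Fin d)) := fun n =>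
    ⟨1 / (n + 1) / 2, 1 / (n + 1), by positivity, half_lt_self (by positivity)⟩
  have hφ : Filter.Tendsto (fun n => (φ n).rOut) Filter.atTop (nhds 0) :=
    tendsto_one_div_add_atTop_nhds_zero_nat
  have hφ1 : ∀ n, (φ n).rOut ≤ 1 := fun n => by
    change (1 : ℝ) / (n + 1) ≤ 1
    rw [div_le_one (by positivity)]; simp
  let G : ℕ → EuclideanSpace ℝ (Fin d) → ℝ := fun n =>
    convolution ((φ n).normed volume) F (lsmul ℝ ℝ) volume
  have hGF : ∀ x, Filter.Tendsto (fun n => G n x) Filter.atTop (nhds (F x)) := fun x =>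
    ContDiffBump.convolution_tendsto_right_of_continuous hφ hF x
  obtain ⟨B, hB⟩ := hF.bounded_above_of_compact_support hFc
  have hGB : ∀ n x, ‖G n x‖ ≤ B := fun n x => by
    simp only [G, normed_convolution_eq_average]
    simpa using norm_integral_le_of_norm_le_const (μ := bumpMeasure (φ n)) (C := B)
      (Filter.Eventually.of_forall fun t => hB (x - t))
  set K : Set (EuclideanSpace ℝ (Fin d)) := 
    Metric.closedBall (0 : EuclideanSpace ℝ (Fin d)) 1 + tsupport F with hK
  have hKc : IsCompact K := (isCompact_closedBall _ _).add hFc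
  have hGK : ∀ n x, x ∉ K → G n x = 0 := fun n x hx => by
    by_contra h
    refine hx ?_
    have h1 := support_convolution_subset (lsmul ℝ ℝ) (μ := volume) (show x ∈ _ from h)
    refine Set.add_subset_add ?_ (subset_tsupport F) h1
    rw [(φ n).support_normed_eq]
    exact Metric.ball_subset_closedBall.trans (Metric.closedBall_subset_closedBall (hφ1 n))
  have hGs : ∀ n, HasCompactSupport (G n) := fun n => HasCompactSupport.intro hKc (hGK n)
  have hGd : ∀ n, ContDiff ℝ (⊤ : ℕ∞) (G n) := fun n =>
    HasCompactSupport.contDiff_convolution_left _ (φ n).hasCompactSupport_normed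
      (φ n).contDiff_normed hF.locallyIntegrable
  have hlim : ∀ μ : Measure (EuclideanSpace ℝ (Fin d)), IsLocallyFiniteMeasure μ →
      Filter.Tendsto (fun n => ∫ x, G n x ∂μ) Filter.atTop (nhds (∫ x, F x ∂μ)) := by
    intro μ hμ
    refine tendsto_integral_of_dominated_convergence (K.indicator fun _ => B)
      (fun n => (hGd n).continuous.aestronglyMeasurable) ?_ ?_
      (Filter.Eventually.of_forall hGF)
    · rw [integrable_indicator_iff hKc.measurableSet]
      exact integrableOn_const hKc.measure_lt_top.ne
    · refine fun n => Filter.Eventually.of_forall fun x => ?_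
      by_cases hx : x ∈ K
      · rw [Set.indicator_of_mem hx]; exact hGB n x
      · rw [Set.indicator_of_notMem hx, hGK n x hx, norm_zero]
  have htend : Filter.Tendsto (fun n => ‖ν.integral (G n)‖ₑ) Filter.atTop
      (nhds ‖ν.integral F‖ₑ) :=
    ((hlim ν.pos inferInstance).sub (hlim ν.neg inferInstance)).enorm
  refine le_of_tendsto' htend fun n => ?_
  have hcs : HasCompactSupport fun x => (G n x : ℂ) :=
    (hGs n).comp_left (g := fun t : ℝ => (t : ℂ)) Complex.ofReal_zero
  let f : 𝓢(EuclideanSpace ℝ (Fin d), ℂ) :=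
    hcs.toSchwartzMap (Complex.ofRealCLM.contDiff.comp (hGd n))
  have hfx : ∀ x, f x = (G n x : ℂ) := fun x => rfl
  have hofReal : ∀ r : ℝ, ‖(r : ℂ)‖ₑ = ‖r‖ₑ := fun r => by simp [enorm_eq_nnnorm]
  have hfG : ‖ν.integral f‖ₑ = ‖ν.integral (G n)‖ₑ := by
    have : ν.integral f = ((ν.integral (G n) : ℝ) : ℂ) := by
      simp only [SignedRadonMeasure.integral, hfx, Complex.ofReal_sub]
      rw [integral_complex_ofReal, integral_complex_ofReal]
    rw [this, hofReal]
  have hsob : sobolevSq s f ≤ sobolevSq s F := by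
    have e : sobolevSq s f = sobolevSq s (G n) := by
      simp only [sobolevSq, gagliardoSq, hfx, ← Complex.ofReal_sub, hofReal]
    rw [e]
    have := sobolevSq_average_le s (bumpMeasure (φ n)) hF hFc
    simp_rw [← normed_convolution_eq_average] at this
    exact this
  rw [← hfG]
  refine (enorm_integral_le_of_isFourierTransform s hw f hcs).trans ?_
  gcongr
  exact (hfour f).trans (by gcongr)

-- Folding space onto a ball.

/-- The retraction of `ℝ^d` onto the closed ball of radius `R` that is the inversion in its
boundary sphere outside of the ball. -/
def foldMap (R : ℝ) (x : EuclideanSpace ℝ (Fin d)) : EuclideanSpace ℝ (Fin d) :=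
  (R / max R ‖x‖) ^ 2 • x

lemma foldMap_of_norm_le {R : ℝ} (hR : 0 < R) {x : EuclideanSpace ℝ (Fin d)} (hx : ‖x‖ ≤ R) :
    foldMap R x = x := by
  rw [foldMap, max_eq_left hx, div_self hR.ne', one_pow, one_smul]

lemma foldMap_of_le_norm {R : ℝ} {x : EuclideanSpace ℝ (Fin d)} (hx : R ≤ ‖x‖) :
    foldMap R x = EuclideanGeometry.inversion 0 R x := by
  rw [foldMap, max_eq_right hx, EuclideanGeometry.inversion]
  simp

lemma norm_foldMap_le {R : ℝ} (hR : 0 < R) (x : EuclideanSpace ℝ (Fin d)) :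
    ‖foldMap R x‖ ≤ R := by
  have h0 : 0 < max R ‖x‖ := lt_max_of_lt_left hR
  rw [foldMap, norm_smul, Real.norm_of_nonneg (by positivity), div_pow, div_mul_eq_mul_div,
    div_le_iff₀ (by positivity)]
  have h1 := le_max_left R ‖x‖
  have h2 := le_max_right R ‖x‖
  nlinarith [mul_le_mul h1 h2 (norm_nonneg x) h0.le]

lemma continuous_foldMap {R : ℝ} (hR : 0 < R) :
    Continuous (foldMap R : EuclideanSpace ℝ (Fin d) → _) := by
  have h : ∀ x : EuclideanSpace ℝ (Fin d), max R ‖x‖ ≠ 0 := fun x => (lt_max_of_lt_left hR).ne'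
  exact ((continuous_const.div (continuous_const.max continuous_norm) h).pow 2).smul continuous_id

lemma foldMap_foldMap {R : ℝ} (hR : 0 < R) (x : EuclideanSpace ℝ (Fin d)) :
    foldMap R (foldMap R x) = foldMap R x :=
  foldMap_of_norm_le hR (norm_foldMap_le hR x)

/-- With `t = R² / ‖y‖²`, one has `‖x - y‖² - ‖x - t y‖² = (1 - t)(‖y‖² + R² - 2⟨x, y⟩)`, and the
last factor is at least `(‖y‖ - R)²`. -/
lemma norm_sub_foldMap_le {R : ℝ} (hR : 0 < R) {x y : EuclideanSpace ℝ (Fin d)} (hx : ‖x‖ ≤ R)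
    (hy : R ≤ ‖y‖) : ‖x - foldMap R y‖ ≤ ‖x - y‖ := by
  have hy0 : 0 < ‖y‖ := hR.trans_le hy
  rw [foldMap, max_eq_right hy]
  set t : ℝ := (R / ‖y‖) ^ 2 with ht
  have ht0 : 0 ≤ t := by positivity
  have ht1 : t ≤ 1 := by
    rw [ht]; exact pow_le_one₀ (by positivity) ((div_le_one hy0).2 hy)
  have hty : t * ‖y‖ ^ 2 = R ^ 2 := by rw [ht]; field_simp
  refine le_of_sq_le_sq ?_ (norm_nonneg _)
  rw [norm_sub_sq_real, norm_sub_sq_real, real_inner_smul_right, norm_smul,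
    Real.norm_of_nonneg ht0]
  have hxy : inner ℝ x y ≤ R * ‖y‖ :=
    (real_inner_le_norm x y).trans (mul_le_mul_of_nonneg_right hx hy0.le)
  have h1 : 0 ≤ ‖y‖ ^ 2 + R ^ 2 - 2 * inner ℝ x y := by nlinarith [sq_nonneg (‖y‖ - R)]
  nlinarith [mul_nonneg (sub_nonneg.2 ht1) h1]

lemma norm_foldMap_sub_foldMap_le {R : ℝ} (hR : 0 < R) (x y : EuclideanSpace ℝ (Fin d)) :
    ‖foldMap R x - foldMap R y‖ ≤ ‖x - y‖ := by
  rcases le_total ‖x‖ R with hx | hx <;> rcases le_total ‖y‖ R with hy | hy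
  · rw [foldMap_of_norm_le hR hx, foldMap_of_norm_le hR hy]
  · rw [foldMap_of_norm_le hR hx]; exact norm_sub_foldMap_le hR hx hy
  · rw [foldMap_of_norm_le hR hy, norm_sub_rev, norm_sub_rev x]
    exact norm_sub_foldMap_le hR hy hx
  -- Inversion multiplies the distance by `R² / (‖x‖ ‖y‖)`, at most `1` when both points lie outside
  -- the ball.
  · have hx0 : 0 < ‖x‖ := hR.trans_le hx
    have hy0 : 0 < ‖y‖ := hR.trans_le hy
    rw [foldMap_of_le_norm hx, foldMap_of_le_norm hy, ← dist_eq_norm,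
      EuclideanGeometry.dist_inversion_inversion (norm_pos_iff.1 hx0) (norm_pos_iff.1 hy0),
      dist_zero_right, dist_zero_right, dist_eq_norm]
    refine mul_le_of_le_one_left (norm_nonneg _) ?_
    rw [div_le_one (by positivity)]
    nlinarith [mul_le_mul hx hy hR.le hx0.le]

/-- Volume is a multiple of the `d`-dimensional Hausdorff measure, which scales this way under
Lipschitz maps. -/
lemma volume_image_le_of_lipschitzOnWith {K : NNReal}
    {f : EuclideanSpace ℝ (Fin d) → EuclideanSpace ℝ (Fin d)} {S : Set (EuclideanSpace ℝ (Fin d))}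
    (hf : LipschitzOnWith K f S) : volume (f '' S) ≤ (K : ℝ≥0∞) ^ d * volume S := by
  have hfin : Module.finrank ℝ (EuclideanSpace ℝ (Fin d)) = d := finrank_euclideanSpace_fin
  have hvol := Measure.isAddLeftInvariant_eq_smul (volume : Measure (EuclideanSpace ℝ (Fin d)))
    (Measure.hausdorffMeasure (Module.finrank ℝ (EuclideanSpace ℝ (Fin d))))
  have h := hf.hausdorffMeasure_image_le (d := (d : ℝ)) (by positivity)
  simp only [hfin] at hvol
  rw [hvol, Measure.smul_apply, Measure.smul_apply, mul_smul_comm]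
  gcongr
  simpa using h

/-- Inversion is an involution, so the preimage of `A` in the large ball is covered by `A` itself
and an inverted image of part of `A`. Points coming from the large ball fold to norm at least `R² /
M`, where inversion is Lipschitz with constant `(M / R)²`. The two pieces give the constants `1` and
`K ^ d`. -/
lemma map_foldMap_restrict_le {R M : ℝ} (hR : 0 < R) (hRM : R ≤ M) :
    ∃ C : ℝ≥0∞, C ≠ ∞ ∧
      (volume.restrict (Metric.closedBall (0 : EuclideanSpace ℝ (Fin d)) M)).map (foldMap R) ≤
        C • volume.restrict (Metric.closedBall 0 R) := by
  have hM : 0 < M := hR.trans_le hRM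
  set K : NNReal := ((M / R) ^ 2).toNNReal with hK
  refine ⟨1 + (K : ℝ≥0∞) ^ d, by simp, ?_⟩
  refine Measure.le_iff.2 fun A hA => ?_
  rw [Measure.map_apply (continuous_foldMap hR).measurable hA,
    Measure.restrict_apply ((continuous_foldMap hR).measurable hA), Measure.smul_apply,
    Measure.restrict_apply hA, smul_eq_mul, add_mul, one_mul]
  set S : Set (EuclideanSpace ℝ (Fin d)) := {x | R ^ 2 / M ≤ ‖x‖} with hS
  have hlip : LipschitzOnWith K (EuclideanGeometry.inversion (0 : EuclideanSpace ℝ (Fin d)) R)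
      (A ∩ Metric.closedBall 0 R ∩ S) := by
    refine LipschitzOnWith.of_dist_le_mul fun x hx y hy => ?_
    have hx1 : R ^ 2 / M ≤ ‖x‖ := hx.2
    have hy1 : R ^ 2 / M ≤ ‖y‖ := hy.2
    have hRM0 : 0 < R ^ 2 / M := by positivity
    have hx0 := hRM0.trans_le hx1
    have hy0 := hRM0.trans_le hy1
    rw [EuclideanGeometry.dist_inversion_inversion (norm_pos_iff.1 hx0) (norm_pos_iff.1 hy0),
      dist_zero_right, dist_zero_right, hK, Real.coe_toNNReal _ (by positivity)]
    refine mul_le_mul_of_nonneg_right ?_ dist_nonneg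
    rw [div_le_iff₀ (by positivity)]
    calc R ^ 2 = (M / R) ^ 2 * (R ^ 2 / M * (R ^ 2 / M)) := by field_simp
      _ ≤ _ := by gcongr
  have hsub : foldMap R ⁻¹' A ∩ Metric.closedBall 0 M ⊆ (A ∩ Metric.closedBall 0 R) ∪
      EuclideanGeometry.inversion 0 R '' (A ∩ Metric.closedBall 0 R ∩ S) := by
    rintro x ⟨hxA, hxM⟩
    rw [mem_closedBall_zero_iff] at hxM
    rcases le_total ‖x‖ R with hx | hx
    · left
      rw [Set.mem_preimage, foldMap_of_norm_le hR hx] at hxA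
      exact ⟨hxA, by simpa using hx⟩
    · right
      have hx0 : 0 < ‖x‖ := hR.trans_le hx
      refine ⟨foldMap R x, ⟨⟨hxA, by simpa using norm_foldMap_le hR x⟩, ?_⟩, ?_⟩
      · rw [hS, Set.mem_ofPred_eq, foldMap_of_le_norm hx]
        have := EuclideanGeometry.dist_inversion_center (0 : EuclideanSpace ℝ (Fin d)) x R
        rw [dist_zero_right, dist_zero_right] at this
        rw [this]
        gcongr
      · rw [foldMap_of_le_norm hx, EuclideanGeometry.inversion_inversion _ hR.ne']
  refine (measure_mono hsub).trans ((measure_union_le _ _).trans ?_)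
  gcongr
  refine (volume_image_le_of_lipschitzOnWith hlip).trans ?_
  exact mul_le_mul_right (measure_mono Set.inter_subset_left) _

-- Cutoffs and the dominating extension.

lemma lintegral_truncated_kernel_lt_top (hd : 1 ≤ d) {s : ℝ} (hs : 0 < s) (hs1 : s < 1) :
    ∫⁻ h : EuclideanSpace ℝ (Fin d), (min 1 ‖h‖ₑ) ^ 2 / ‖h‖ₑ ^ ((d : ℝ) + 2 * s) < ∞ := by
  have : Nonempty (Fin d) := ⟨⟨0, hd⟩⟩
  set p := (d : ℝ) + 2 * s with hp
  have hp0 : 0 < p := by positivity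
  have hint : Integrable fun h : EuclideanSpace ℝ (Fin d) => (min 1 ‖h‖) ^ 2 / ‖h‖ ^ p := by
    rw [integrable_fun_norm_addHaar volume (f := fun t : ℝ => (min 1 t) ^ 2 / t ^ p),
      finrank_euclideanSpace_fin, ← Set.Ioc_union_Ioi_eq_Ioi (zero_le_one' ℝ)]
    -- In polar coordinates the integrand is `t ^ (1 - 2s)` near `0`, integrable as `s < 1`, and `t
    -- ^ (-1 - 2s)` at infinity, integrable as `s > 0`.
    have hpow : ∀ t : ℝ, 0 < t → t ^ (d - 1) / t ^ p = t ^ (-1 - 2 * s) := fun t ht => by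
      rw [← Real.rpow_natCast, ← Real.rpow_sub ht, Nat.cast_sub hd, hp]
      congr 1
      push_cast
      ring
    refine IntegrableOn.union ?_ ?_
    · have h1 : IntegrableOn (fun t : ℝ => t ^ (1 - 2 * s)) (Set.Ioc 0 1) :=
        (intervalIntegrable_iff_integrableOn_Ioc_of_le zero_le_one).1
          (intervalIntegral.intervalIntegrable_rpow' (by linarith))
      refine h1.congr_fun (fun t ht => ?_) measurableSet_Ioc
      simp only [smul_eq_mul]
      rw [min_eq_right ht.2, mul_div_left_comm, hpow t ht.1, ← Real.rpow_natCast,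
        ← Real.rpow_add ht.1]
      congr 1
      push_cast
      ring
    · have h1 : IntegrableOn (fun t : ℝ => t ^ (-1 - 2 * s)) (Set.Ioi 1) :=
        integrableOn_Ioi_rpow_of_lt (by linarith) one_pos
      refine h1.congr_fun (fun t ht => ?_) measurableSet_Ioi
      simp only [smul_eq_mul]
      rw [min_eq_left (le_of_lt ht), one_pow, mul_one_div, hpow t (one_pos.trans ht)]
  have h2 := hint.lintegral_lt_top
  refine lt_of_eq_of_lt (lintegral_congr fun h => ?_) h2
  rcases eq_or_ne h 0 with rfl | hh
  · simp
  have hn : 0 < ‖h‖ := norm_pos_iff.2 hh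
  rw [ENNReal.ofReal_div_of_pos (by positivity), ENNReal.ofReal_pow (by positivity),
    ENNReal.ofReal_min, ENNReal.ofReal_one, ← ENNReal.ofReal_rpow_of_pos hn, ofReal_norm]

/-- A Lipschitz cutoff that is `1` on the ball of radius `a` and `0` off the ball of radius
`a + 1`. -/
def cutoff (a : ℝ) (x : EuclideanSpace ℝ (Fin d)) : ℝ :=
  max 0 (min 1 (a + 1 - ‖x‖))

lemma continuous_cutoff (a : ℝ) : Continuous (cutoff a : EuclideanSpace ℝ (Fin d) → ℝ) :=
  continuous_const.max (continuous_const.min (continuous_const.sub continuous_norm))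

lemma cutoff_nonneg (a : ℝ) (x : EuclideanSpace ℝ (Fin d)) : 0 ≤ cutoff a x := le_max_left _ _

lemma cutoff_le_one (a : ℝ) (x : EuclideanSpace ℝ (Fin d)) : cutoff a x ≤ 1 :=
  max_le zero_le_one (min_le_left _ _)

lemma cutoff_of_norm_le {a : ℝ} {x : EuclideanSpace ℝ (Fin d)} (hx : ‖x‖ ≤ a) :
    cutoff a x = 1 := by
  rw [cutoff, min_eq_left (by linarith), max_eq_right zero_le_one]

lemma cutoff_of_le_norm {a : ℝ} {x : EuclideanSpace ℝ (Fin d)} (hx : a + 1 ≤ ‖x‖) :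
    cutoff a x = 0 :=
  max_eq_left (min_le_of_right_le (by linarith))

lemma cutoff_mono {a b : ℝ} (hab : a ≤ b) (x : EuclideanSpace ℝ (Fin d)) :
    cutoff a x ≤ cutoff b x := by
  unfold cutoff; gcongr

lemma abs_cutoff_sub_le (a : ℝ) (x y : EuclideanSpace ℝ (Fin d)) :
    |cutoff a x - cutoff a y| ≤ min 1 ‖x - y‖ := by
  refine le_min ?_ ?_
  · rw [abs_le]
    constructor <;>
      linarith [cutoff_nonneg a x, cutoff_nonneg a y, cutoff_le_one a x, cutoff_le_one a y]
  · have h := abs_norm_sub_norm_le x y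
    unfold cutoff
    rw [max_comm 0, max_comm 0, min_comm 1, min_comm 1]
    refine (abs_max_sub_max_le_abs _ _ _).trans (le_trans ?_ h)
    refine (abs_min_sub_min_le_max _ _ _ _).trans ?_
    rw [sub_self, abs_zero, sub_sub_sub_cancel_left, abs_sub_comm, max_eq_left (abs_nonneg _)]

/-- The extension of `φ` from the closed ball of radius `r + 1` to a compactly supported function
that equals `φ` on the ball of radius `r` and dominates it on the ball of radius `r + 1`. -/
def dominatingExtension (r : ℝ) (φ : EuclideanSpace ℝ (Fin d) → ℝ)
    (x : EuclideanSpace ℝ (Fin d)) : ℝ :=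
  cutoff r x * φ (foldMap (r + 1) x) + (cutoff (r + 1) x - cutoff r x) * |φ (foldMap (r + 1) x)|

lemma continuous_comp_foldMap {R : ℝ} (hR : 0 < R) {φ : EuclideanSpace ℝ (Fin d) → ℝ}
    (hφ : ContinuousOn φ (Metric.closedBall 0 R)) : Continuous fun x => φ (foldMap R x) :=
  hφ.comp_continuous (continuous_foldMap hR) fun x => by simpa using norm_foldMap_le hR x

lemma continuous_dominatingExtension {r : ℝ} (hr : 0 < r) {φ : EuclideanSpace ℝ (Fin d) → ℝ}
    (hφ : ContinuousOn φ (Metric.closedBall 0 (r + 1))) :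
    Continuous (dominatingExtension r φ) := by
  have h := continuous_comp_foldMap (by positivity) hφ
  exact ((continuous_cutoff r).mul h).add
    (((continuous_cutoff (r + 1)).sub (continuous_cutoff r)).mul h.abs)

lemma dominatingExtension_eq_zero {r : ℝ} (φ : EuclideanSpace ℝ (Fin d) → ℝ)
    {x : EuclideanSpace ℝ (Fin d)} (hx : r + 2 ≤ ‖x‖) : dominatingExtension r φ x = 0 := by
  rw [dominatingExtension, cutoff_of_le_norm (by linarith), cutoff_of_le_norm (by linarith)]
  ring

lemma hasCompactSupport_dominatingExtension (r : ℝ) (φ : EuclideanSpace ℝ (Fin d) → ℝ) :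
    HasCompactSupport (dominatingExtension r φ) :=
  HasCompactSupport.intro (isCompact_closedBall 0 (r + 2)) fun x hx =>
    dominatingExtension_eq_zero φ (by
      rw [mem_closedBall_zero_iff, not_le] at hx
      exact hx.le)

lemma dominatingExtension_eq {r : ℝ} (hr : 0 < r) (φ : EuclideanSpace ℝ (Fin d) → ℝ)
    {x : EuclideanSpace ℝ (Fin d)} (hx : ‖x‖ ≤ r) : dominatingExtension r φ x = φ x := by
  rw [dominatingExtension, cutoff_of_norm_le hx, cutoff_of_norm_le (by linarith),
    foldMap_of_norm_le (by linarith) (by linarith)]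
  ring

lemma le_dominatingExtension {r : ℝ} (hr : 0 < r) (φ : EuclideanSpace ℝ (Fin d) → ℝ)
    (x : EuclideanSpace ℝ (Fin d)) :
    (Metric.closedBall 0 (r + 1)).indicator φ x ≤ dominatingExtension r φ x := by
  rcases le_or_gt ‖x‖ (r + 1) with hx | hx
  -- On `B` the outer cutoff is `1`, so the extension is a convex combination of `φ` and `|φ|`.
  · rw [Set.indicator_of_mem (by simpa using hx), dominatingExtension, cutoff_of_norm_le hx,
      foldMap_of_norm_le (by linarith) hx]
    nlinarith [mul_le_mul_of_nonneg_left (le_abs_self (φ x)) (sub_nonneg.2 (cutoff_le_one r x))]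
  · rw [Set.indicator_of_notMem (by simpa using hx), dominatingExtension,
      cutoff_of_le_norm (a := r) hx.le]
    have := mul_nonneg (cutoff_nonneg (r + 1) x) (abs_nonneg (φ (foldMap (r + 1) x)))
    linarith

lemma abs_dominatingExtension_le (r : ℝ) (φ : EuclideanSpace ℝ (Fin d) → ℝ)
    (x : EuclideanSpace ℝ (Fin d)) :
    |dominatingExtension r φ x| ≤ |φ (foldMap (r + 1) x)| := by
  have h0 := cutoff_nonneg r x
  have h1 := cutoff_le_one (r + 1) x
  have h2 := cutoff_mono (by linarith : r ≤ r + 1) x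
  rw [dominatingExtension]
  refine (abs_add_le _ _).trans ?_
  rw [abs_mul, abs_mul, abs_abs, abs_of_nonneg h0, abs_of_nonneg (sub_nonneg.2 h2)]
  nlinarith [abs_nonneg (φ (foldMap (r + 1) x))]

lemma abs_dominatingExtension_sub_le (r : ℝ) (φ : EuclideanSpace ℝ (Fin d) → ℝ)
    (x y : EuclideanSpace ℝ (Fin d)) :
    |dominatingExtension r φ x - dominatingExtension r φ y| ≤
      |φ (foldMap (r + 1) x) - φ (foldMap (r + 1) y)| +
        3 * (min 1 ‖x - y‖ * |φ (foldMap (r + 1) y)|) := by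
  set a := φ (foldMap (r + 1) x)
  set b := φ (foldMap (r + 1) y)
  have h0 := cutoff_nonneg r x
  have h1 := cutoff_le_one (r + 1) x
  have h2 := sub_nonneg.2 (cutoff_mono (by linarith : r ≤ r + 1) x)
  have h3 := abs_cutoff_sub_le r x y
  have h4 := abs_cutoff_sub_le (r + 1) x y
  -- A product rule: the first bracket moves `Φ` with the cutoffs fixed at `x`, with weights of sum
  -- at most `1`; the second moves the cutoffs in three terms, hence the factor `3`.
  have e : dominatingExtension r φ x - dominatingExtension r φ y =
      (cutoff r x * (a - b) + (cutoff (r + 1) x - cutoff r x) * (|a| - |b|)) +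
      ((cutoff r x - cutoff r y) * b + ((cutoff (r + 1) x - cutoff (r + 1) y) * |b| -
        (cutoff r x - cutoff r y) * |b|)) := by
    simp only [dominatingExtension, a, b]; ring
  rw [e]
  refine (abs_add_le _ _).trans (add_le_add ?_ ?_)
  · refine (abs_add_le _ _).trans ?_
    rw [abs_mul, abs_mul, abs_of_nonneg h0, abs_of_nonneg h2]
    have h5 := abs_abs_sub_abs_le_abs_sub a b
    nlinarith [mul_le_mul_of_nonneg_left h5 h2, abs_nonneg (a - b)]
  · refine (abs_add_le _ _).trans ((add_le_add le_rfl (abs_sub _ _)).trans ?_)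
    rw [abs_mul, abs_mul, abs_mul, abs_abs]
    have h6 := mul_le_mul_of_nonneg_right h3 (abs_nonneg b)
    have h7 := mul_le_mul_of_nonneg_right h4 (abs_nonneg b)
    linarith

/-- Pointwise bound for the Gagliardo difference of the extension. -/
lemma enorm_dominatingExtension_sub_sq_le (r : ℝ) (φ : EuclideanSpace ℝ (Fin d) → ℝ)
    (x y : EuclideanSpace ℝ (Fin d)) :
    ‖dominatingExtension r φ x - dominatingExtension r φ y‖ₑ ^ 2 ≤
      (Metric.closedBall 0 (r + 3)).indicator (fun x => (Metric.closedBall 0 (r + 3)).indicator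
        (fun y => 2 * ‖φ (foldMap (r + 1) x) - φ (foldMap (r + 1) y)‖ₑ ^ 2) y) x +
      18 * ((min 1 ‖x - y‖ₑ) ^ 2 *
        ((Metric.closedBall 0 (r + 3)).indicator (fun x => ‖φ (foldMap (r + 1) x)‖ₑ ^ 2) x +
        (Metric.closedBall 0 (r + 3)).indicator (fun x => ‖φ (foldMap (r + 1) x)‖ₑ ^ 2) y)) := by
  -- The extension vanishes from radius `r + 2` on, so with `y` beyond `r + 3` either the left side
  -- is `0` or `‖x - y‖ ≥ 1` and the truncation equals `1`.
  have hout : ∀ x y : EuclideanSpace ℝ (Fin d), y ∉ Metric.closedBall 0 (r + 3) →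
      x ∈ Metric.closedBall 0 (r + 3) →
      ‖dominatingExtension r φ x‖ₑ ^ 2 ≤
        18 * ((min 1 ‖x - y‖ₑ) ^ 2 * ‖φ (foldMap (r + 1) x)‖ₑ ^ 2) := by
    intro x y hy hx
    rw [mem_closedBall_zero_iff, not_le] at hy
    rcases le_or_gt (r + 2) ‖x‖ with h | h
    · simp [dominatingExtension_eq_zero φ h]
    · have h1 : 1 ≤ ‖x - y‖ := by
        have := norm_sub_norm_le y x
        rw [norm_sub_rev] at this
        linarith
      have h2 : (1 : ℝ≥0∞) ≤ ‖x - y‖ₑ := by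
        rw [← ofReal_norm]; simpa using ENNReal.ofReal_le_ofReal h1
      rw [min_eq_left h2, one_pow, one_mul]
      have h3 : ‖dominatingExtension r φ x‖ₑ ≤ ‖φ (foldMap (r + 1) x)‖ₑ := by
        rw [enorm_le_iff_norm_le]
        exact abs_dominatingExtension_le r φ x
      calc ‖dominatingExtension r φ x‖ₑ ^ 2 ≤ ‖φ (foldMap (r + 1) x)‖ₑ ^ 2 := by gcongr
        _ ≤ _ := le_mul_of_one_le_left (by simp) (by norm_num)
  by_cases hx : x ∈ Metric.closedBall 0 (r + 3) <;> by_cases hy : y ∈ Metric.closedBall 0 (r + 3)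
  · rw [Set.indicator_of_mem hx, Set.indicator_of_mem hy, Set.indicator_of_mem hx,
      Set.indicator_of_mem hy]
    set a := φ (foldMap (r + 1) x)
    set b := φ (foldMap (r + 1) y)
    have h := abs_dominatingExtension_sub_le r φ x y
    have h2 : (|dominatingExtension r φ x - dominatingExtension r φ y|) ^ 2 ≤
        2 * |a - b| ^ 2 + 18 * ((min 1 ‖x - y‖) ^ 2 * |b| ^ 2) := by
      refine (pow_le_pow_left₀ (abs_nonneg _) h 2).trans ?_
      -- This is `(u + 3v)² ≤ 2u² + 18v²`.
      nlinarith [sq_nonneg (|a - b| - 3 * (min 1 ‖x - y‖ * |b|))]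
    have h3 := ENNReal.ofReal_le_ofReal h2
    have hm : 0 ≤ min 1 ‖x - y‖ := le_min zero_le_one (norm_nonneg _)
    rw [ENNReal.ofReal_add (by positivity) (by positivity), ENNReal.ofReal_mul (by positivity),
      ENNReal.ofReal_mul (by positivity), ENNReal.ofReal_mul (by positivity),
      ENNReal.ofReal_pow (abs_nonneg _), ENNReal.ofReal_pow (abs_nonneg _),
      ENNReal.ofReal_pow (abs_nonneg _), ENNReal.ofReal_pow hm, ENNReal.ofReal_min, ofReal_norm,
      ← Real.enorm_eq_ofReal_abs, ← Real.enorm_eq_ofReal_abs, ← Real.enorm_eq_ofReal_abs,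
      ENNReal.ofReal_one, ENNReal.ofReal_ofNat, ENNReal.ofReal_ofNat] at h3
    refine h3.trans ?_
    gcongr
    exact le_add_left le_rfl
  · have hy0 : dominatingExtension r φ y = 0 := dominatingExtension_eq_zero φ (by
      rw [mem_closedBall_zero_iff, not_le] at hy; linarith)
    rw [hy0, sub_zero]
    simpa [hx, hy] using hout x y hy hx
  · have hx0 : dominatingExtension r φ x = 0 := dominatingExtension_eq_zero φ (by
      rw [mem_closedBall_zero_iff, not_le] at hx; linarith)
    rw [hx0, zero_sub, enorm_neg, ← enorm_neg (x - y), neg_sub]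
    simpa [hx, hy] using hout y x hx hy
  · have hy0 : dominatingExtension r φ y = 0 := dominatingExtension_eq_zero φ (by
      rw [mem_closedBall_zero_iff, not_le] at hy; linarith)
    have hx0 : dominatingExtension r φ x = 0 := dominatingExtension_eq_zero φ (by
      rw [mem_closedBall_zero_iff, not_le] at hx; linarith)
    simp [hx0, hy0]

-- Sobolev bound for the extension.

lemma hNormOn_sq (s : ℝ) (A : Set (EuclideanSpace ℝ (Fin d)))
    (φ : EuclideanSpace ℝ (Fin d) → ℝ) :
    hNormOn s A φ ^ 2 = (∫⁻ x in A, ‖φ x‖ₑ ^ 2) +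
      ∫⁻ x in A, ∫⁻ y in A, ‖φ x - φ y‖ₑ ^ 2 / ‖x - y‖ₑ ^ ((d : ℝ) + 2 * s) := by
  rw [hNormOn, ← ENNReal.rpow_natCast, ← ENNReal.rpow_mul]
  norm_num

lemma hNormOn_neg (s : ℝ) (A : Set (EuclideanSpace ℝ (Fin d)))
    (φ : EuclideanSpace ℝ (Fin d) → ℝ) : hNormOn s A (-φ) = hNormOn s A φ := by
  have h : ∀ x y, ‖-φ x - -φ y‖ₑ = ‖φ x - φ y‖ₑ := fun x y => by
    rw [← enorm_neg, neg_sub_neg, neg_sub]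
  simp only [hNormOn, Pi.neg_apply, enorm_neg, h]

lemma hNormOn_congr (s : ℝ) {A : Set (EuclideanSpace ℝ (Fin d))} (hA : MeasurableSet A)
    {φ ψ : EuclideanSpace ℝ (Fin d) → ℝ} (h : Set.EqOn φ ψ A) : hNormOn s A φ = hNormOn s A ψ := by
  unfold hNormOn
  congr 2
  · exact setLIntegral_congr_fun hA fun x hx => by simp only [h hx]
  · exact setLIntegral_congr_fun hA fun x hx =>
      setLIntegral_congr_fun hA fun y hy => by simp only [h hx, h hy]

lemma setLIntegral_comp_le_of_map_le {A B : Set (EuclideanSpace ℝ (Fin d))} {C : ℝ≥0∞}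
    {ρ : EuclideanSpace ℝ (Fin d) → EuclideanSpace ℝ (Fin d)} (hρ : Measurable ρ)
    (hmap : (volume.restrict A).map ρ ≤ C • volume.restrict B)
    {g : EuclideanSpace ℝ (Fin d) → ℝ≥0∞} (hg : Measurable g) :
    ∫⁻ x in A, g (ρ x) ≤ C * ∫⁻ x in B, g x := by
  rw [← lintegral_map hg hρ, ← smul_eq_mul, ← lintegral_smul_measure]
  exact lintegral_mono' hmap le_rfl

lemma setLIntegral_setLIntegral_comp_le_of_map_le {A B : Set (EuclideanSpace ℝ (Fin d))}
    {C : ℝ≥0∞} (hC : C ≠ ∞) {ρ : EuclideanSpace ℝ (Fin d) → EuclideanSpace ℝ (Fin d)}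
    (hρ : Measurable ρ) (hmap : (volume.restrict A).map ρ ≤ C • volume.restrict B)
    {g : EuclideanSpace ℝ (Fin d) × EuclideanSpace ℝ (Fin d) → ℝ≥0∞} (hg : Measurable g) :
    ∫⁻ x in A, ∫⁻ y in A, g (ρ x, ρ y) ≤ C ^ 2 * ∫⁻ x in B, ∫⁻ y in B, g (x, y) := by
  calc ∫⁻ x in A, ∫⁻ y in A, g (ρ x, ρ y)
      ≤ ∫⁻ x in A, C * ∫⁻ y in B, g (ρ x, y) :=
        lintegral_mono fun x => setLIntegral_comp_le_of_map_le hρ hmap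
          (hg.comp measurable_prodMk_left)
    _ = C * ∫⁻ x in A, ∫⁻ y in B, g (ρ x, y) := lintegral_const_mul' _ _ hC
    _ ≤ C * (C * ∫⁻ x in B, ∫⁻ y in B, g (x, y)) :=
        mul_le_mul_right (setLIntegral_comp_le_of_map_le hρ hmap
          (g := fun x => ∫⁻ y in B, g (x, y)) hg.lintegral_prod_right') _
    _ = _ := by ring

/-- Functions that factor through a `1`-Lipschitz map whose push-forward of the volume is
controlled: the `H^s` norm on the larger set is controlled by the one on the smaller set. -/
lemma lintegral_gagliardo_comp_le {A B : Set (EuclideanSpace ℝ (Fin d))} {C : ℝ≥0∞} (hC : C ≠ ∞)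
    {ρ : EuclideanSpace ℝ (Fin d) → EuclideanSpace ℝ (Fin d)} (hρ : Measurable ρ)
    (hlip : ∀ x y, ‖ρ x - ρ y‖ ≤ ‖x - y‖)
    (hmap : (volume.restrict A).map ρ ≤ C • volume.restrict B) {p : ℝ} (hp : 0 ≤ p)
    {Φ : EuclideanSpace ℝ (Fin d) → ℝ} (hΦ : Continuous Φ) (hΦρ : ∀ x, Φ (ρ x) = Φ x) :
    ∫⁻ x in A, ∫⁻ y in A, ‖Φ x - Φ y‖ₑ ^ 2 / ‖x - y‖ₑ ^ p ≤
      C ^ 2 * ∫⁻ x in B, ∫⁻ y in B, ‖Φ x - Φ y‖ₑ ^ 2 / ‖x - y‖ₑ ^ p := by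
  refine le_trans ?_ (setLIntegral_setLIntegral_comp_le_of_map_le hC hρ hmap
    (measurable_gagliardo_integrand p hΦ))
  refine lintegral_mono fun x => lintegral_mono fun y => ?_
  simp only [hΦρ]
  gcongr
  exact enorm_le_iff_norm_le.2 (hlip x y)

/-- Measurability is asked of one summand only, so the nested indicator term needs none. -/
lemma lintegral_lintegral_add_right (f : EuclideanSpace ℝ (Fin d) → EuclideanSpace ℝ (Fin d) → ℝ≥0∞)
    {g : EuclideanSpace ℝ (Fin d) × EuclideanSpace ℝ (Fin d) → ℝ≥0∞} (hg : Measurable g) :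
    ∫⁻ x, ∫⁻ y, (f x y + g (x, y)) = (∫⁻ x, ∫⁻ y, f x y) + ∫⁻ x, ∫⁻ y, g (x, y) := by
  have hin : ∀ x, ∫⁻ y, (f x y + g (x, y)) = (∫⁻ y, f x y) + ∫⁻ y, g (x, y) := fun x =>
    lintegral_add_right _ (hg.comp measurable_prodMk_left)
  simp_rw [hin]
  exact lintegral_add_right _ hg.lintegral_prod_right'

/-- By translation invariance each term contributes `(∫ k)(∫ a)`, the second after Tonelli; hence
the factor `2`. -/
lemma lintegral_lintegral_kernel_mul_add {k a : EuclideanSpace ℝ (Fin d) → ℝ≥0∞}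
    (hk : Measurable k) (ha : Measurable a) {c : ℝ≥0∞} (hc : c ≠ ∞) :
    ∫⁻ x, ∫⁻ y, c * (k (x - y) * a x + k (x - y) * a y) =
      2 * c * (∫⁻ h, k h) * ∫⁻ x, a x := by
  have hkx : Measurable fun z : EuclideanSpace ℝ (Fin d) × EuclideanSpace ℝ (Fin d) =>
      k (z.1 - z.2) := hk.comp (measurable_fst.sub measurable_snd)
  have hleft : ∀ x, ∫⁻ y, k (x - y) * a x = (∫⁻ h, k h) * a x := fun x => by
    have hx : Measurable fun y => k (x - y) := hkx.comp measurable_prodMk_left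
    rw [lintegral_mul_const _ hx, lintegral_sub_left_eq_self]
  have hright : ∀ y, ∫⁻ x, k (x - y) * a y = (∫⁻ h, k h) * a y := fun y => by
    have hy : Measurable fun x => k (x - y) := hkx.comp measurable_prodMk_right
    rw [lintegral_mul_const _ hy, lintegral_sub_right_eq_self]
  have hmr : Measurable fun z : EuclideanSpace ℝ (Fin d) × EuclideanSpace ℝ (Fin d) =>
      k (z.1 - z.2) * a z.2 := hkx.mul (ha.comp measurable_snd)
  have hswap : ∫⁻ x, ∫⁻ y, k (x - y) * a y = (∫⁻ h, k h) * ∫⁻ x, a x := by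
    rw [lintegral_lintegral_swap hmr.aemeasurable]
    simp_rw [hright]
    exact lintegral_const_mul _ ha
  have hinner : ∀ x, ∫⁻ y, c * (k (x - y) * a x + k (x - y) * a y) =
      c * ((∫⁻ h, k h) * a x + ∫⁻ y, k (x - y) * a y) := fun x => by
    rw [lintegral_const_mul' _ _ hc, ← hleft x]
    congr 1
    exact lintegral_add_right _ (hmr.comp measurable_prodMk_left)
  simp_rw [hinner]
  rw [lintegral_const_mul' _ _ hc, lintegral_add_left (ha.const_mul _), hswap,
    lintegral_const_mul _ ha]
  ring

/-- The `H^s(ℝ^d)` norm of the extension is controlled by the `H^s` norm on the ball. -/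
lemma exists_sobolevSq_dominatingExtension_le (hd : 1 ≤ d) {s : ℝ} (hs : 0 < s) (hs1 : s < 1)
    {r : ℝ} (hr : 0 < r) :
    ∃ C : ℝ≥0∞, C ≠ ∞ ∧ ∀ φ : EuclideanSpace ℝ (Fin d) → ℝ,
      ContinuousOn φ (Metric.closedBall 0 (r + 1)) →
        sobolevSq s (dominatingExtension r φ) ≤
          C * hNormOn s (Metric.closedBall 0 (r + 1)) φ ^ 2 := by
  set p := (d : ℝ) + 2 * s with hp
  have hp0 : 0 ≤ p := by positivity
  have hR : 0 < r + 1 := by positivity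
  obtain ⟨C, hC, hmap⟩ := map_foldMap_restrict_le (d := d) hR (by linarith : r + 1 ≤ r + 3)
  set k : EuclideanSpace ℝ (Fin d) → ℝ≥0∞ := fun h => (min 1 ‖h‖ₑ) ^ 2 / ‖h‖ₑ ^ p with hk
  have hkm : Measurable k :=
    ((measurable_const.min measurable_id.enorm).pow_const 2).div
      (measurable_id.enorm.pow_const p)
  set κ := ∫⁻ h, k h with hκ
  have hκt : κ ≠ ∞ := (lintegral_truncated_kernel_lt_top hd hs hs1).ne
  -- The summands come from the `L²` norm, from the variation of the cutoffs, and from the Gagliardo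
  -- integral of the folded function, where the volume distortion enters twice.
  refine ⟨C + 36 * κ * C + 2 * C ^ 2, ?_, fun φ hφ => ?_⟩
  · simp [ENNReal.add_eq_top, ENNReal.mul_eq_top, hC, hκt]
  set B : Set (EuclideanSpace ℝ (Fin d)) := Metric.closedBall 0 (r + 1) with hB
  set A : Set (EuclideanSpace ℝ (Fin d)) := Metric.closedBall 0 (r + 3) with hA
  have hAm : MeasurableSet A := Metric.isClosed_closedBall.measurableSet
  have hBm : MeasurableSet B := Metric.isClosed_closedBall.measurableSet
  set Φ : EuclideanSpace ℝ (Fin d) → ℝ := fun x => φ (foldMap (r + 1) x) with hΦ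
  have hΦc : Continuous Φ := continuous_comp_foldMap hR hφ
  have hΦρ : ∀ x, Φ (foldMap (r + 1) x) = Φ x := fun x => by
    simp only [hΦ, foldMap_foldMap hR]
  have hφΦ : hNormOn s B φ = hNormOn s B Φ := hNormOn_congr s hBm fun x hx => by
    simp only [hΦ, foldMap_of_norm_le hR (mem_closedBall_zero_iff.1 hx)]
  set I := ∫⁻ x in A, ‖Φ x‖ₑ ^ 2 with hI
  set J := ∫⁻ x in A, ∫⁻ y in A, ‖Φ x - Φ y‖ₑ ^ 2 / ‖x - y‖ₑ ^ p with hJ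
  have hIle : I ≤ C * ∫⁻ x in B, ‖Φ x‖ₑ ^ 2 := by
    have := setLIntegral_comp_le_of_map_le (continuous_foldMap hR).measurable hmap
      (g := fun x => ‖Φ x‖ₑ ^ 2) (hΦc.enorm.measurable.pow_const 2)
    simpa only [hΦρ] using this
  have hJle : J ≤ C ^ 2 * ∫⁻ x in B, ∫⁻ y in B, ‖Φ x - Φ y‖ₑ ^ 2 / ‖x - y‖ₑ ^ p :=
    lintegral_gagliardo_comp_le hC (continuous_foldMap hR).measurable
      (norm_foldMap_sub_foldMap_le hR) hmap hp0 hΦc hΦρ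
  set a : EuclideanSpace ℝ (Fin d) → ℝ≥0∞ := A.indicator fun x => ‖Φ x‖ₑ ^ 2 with ha
  have ham : Measurable a := (hΦc.enorm.measurable.pow_const 2).indicator hAm
  have haI : ∫⁻ x, a x = I := lintegral_indicator hAm _
  have hL2 : ∫⁻ x, ‖dominatingExtension r φ x‖ₑ ^ 2 ≤ I := by
    rw [← haI]
    refine lintegral_mono fun x => ?_
    by_cases hx : x ∈ A
    · simp only [ha, Set.indicator_of_mem hx]
      gcongr
      exact enorm_le_iff_norm_le.2 (abs_dominatingExtension_le r φ x)
    · rw [hA, mem_closedBall_zero_iff, not_le] at hx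
      simp [dominatingExtension_eq_zero φ (show r + 2 ≤ ‖x‖ by linarith)]
  have hkx : Measurable fun z : EuclideanSpace ℝ (Fin d) × EuclideanSpace ℝ (Fin d) =>
      k (z.1 - z.2) := hkm.comp (measurable_fst.sub measurable_snd)
  have hT : ∫⁻ x, ∫⁻ y, 18 * (k (x - y) * a x + k (x - y) * a y) = 36 * κ * I := by
    rw [lintegral_lintegral_kernel_mul_add hkm ham (by simp), haI]
    ring
  have hgag : gagliardoSq s (dominatingExtension r φ) ≤ 2 * J + 36 * κ * I := by
    have hdiv : Measurable fun z : EuclideanSpace ℝ (Fin d) × EuclideanSpace ℝ (Fin d) =>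
        18 * (k (z.1 - z.2) * a z.1 + k (z.1 - z.2) * a z.2) :=
      ((hkx.mul (ham.comp measurable_fst)).add (hkx.mul (ham.comp measurable_snd))).const_mul _
    calc gagliardoSq s (dominatingExtension r φ)
        ≤ ∫⁻ x, ∫⁻ y, (A.indicator (fun x => A.indicator
            (fun y => 2 * (‖Φ x - Φ y‖ₑ ^ 2 / ‖x - y‖ₑ ^ p)) y) x +
            18 * (k (x - y) * a x + k (x - y) * a y)) := by
          refine lintegral_mono fun x => lintegral_mono fun y => ?_
          refine (ENNReal.div_le_div_right (enorm_dominatingExtension_sub_sq_le r φ x y) _).trans ?_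
          rw [ENNReal.add_div]
          refine add_le_add (le_of_eq ?_) (le_of_eq ?_)
          · by_cases hx : x ∈ A <;> by_cases hy : y ∈ A <;>
              simp [← hA, hx, hy, hΦ, ← hp, mul_div_assoc]
          · simp only [hk, ha, ← hp, ← hA, hΦ, div_eq_mul_inv]
            ring
      _ = (∫⁻ x, ∫⁻ y, A.indicator (fun x => A.indicator
            (fun y => 2 * (‖Φ x - Φ y‖ₑ ^ 2 / ‖x - y‖ₑ ^ p)) y) x) +
            ∫⁻ x, ∫⁻ y, 18 * (k (x - y) * a x + k (x - y) * a y) := by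
          exact lintegral_lintegral_add_right _ hdiv
      _ = 2 * J + 36 * κ * I := by
          congr 1
          · rw [hJ, ← lintegral_const_mul' _ _ (by simp), ← lintegral_indicator hAm]
            refine lintegral_congr fun x => ?_
            by_cases hx : x ∈ A
            · simp only [Set.indicator_of_mem hx]
              rw [lintegral_indicator hAm, lintegral_const_mul' _ _ (by simp)]
            · simp only [Set.indicator_of_notMem hx, lintegral_zero]
  rw [hφΦ, hNormOn_sq, ← hp]
  set I₀ := ∫⁻ x in B, ‖Φ x‖ₑ ^ 2
  set J₀ := ∫⁻ x in B, ∫⁻ y in B, ‖Φ x - Φ y‖ₑ ^ 2 / ‖x - y‖ₑ ^ p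
  calc sobolevSq s (dominatingExtension r φ) ≤ I + (2 * J + 36 * κ * I) := add_le_add hL2 hgag
    _ ≤ C * I₀ + (2 * (C ^ 2 * J₀) + 36 * κ * (C * I₀)) := by gcongr
    _ = (C + 36 * κ * C) * I₀ + 2 * C ^ 2 * J₀ := by ring
    _ ≤ (C + 36 * κ * C + 2 * C ^ 2) * I₀ + (C + 36 * κ * C + 2 * C ^ 2) * J₀ := by
        exact add_le_add (mul_le_mul_left (le_add_right le_rfl) _)
          (mul_le_mul_left (le_add_left le_rfl) _)
    _ = _ := by ring

-- Using the sign of the measure, and conclusion.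

lemma integral_le_integral_of_restrict_compl_le {Ω : Set (EuclideanSpace ℝ (Fin d))}
    {μ₁ μ₂ : Measure (EuclideanSpace ℝ (Fin d))}
    (h : ∀ A, MeasurableSet A → A ⊆ Ωᶜ → μ₁ A ≤ μ₂ A) (hΩ : MeasurableSet Ω)
    {G : EuclideanSpace ℝ (Fin d) → ℝ} (hG : ∀ x, 0 ≤ G x) (hGΩ : ∀ x ∈ Ω, G x = 0)
    (hGi : Integrable G μ₂) : ∫ x, G x ∂μ₁ ≤ ∫ x, G x ∂μ₂ := by
  have hle : μ₁.restrict Ωᶜ ≤ μ₂.restrict Ωᶜ := by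
    refine Measure.le_iff.2 fun A hA => ?_
    rw [Measure.restrict_apply hA, Measure.restrict_apply hA]
    exact h _ (hA.inter hΩ.compl) Set.inter_subset_right
  have hset : ∀ μ : Measure (EuclideanSpace ℝ (Fin d)), ∫ x in Ωᶜ, G x ∂μ = ∫ x, G x ∂μ :=
    fun μ => setIntegral_eq_integral_of_forall_compl_eq_zero fun x hx => hGΩ x (by simpa using hx)
  rw [← hset μ₁, ← hset μ₂]
  exact integral_mono_measure hle (Filter.Eventually.of_forall hG) hGi.integrableOn

/-- If `μ₁ ≤ μ₂` off `Ω`, integrals over the ball are dominated by those of the extension. -/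
lemma setIntegral_sub_le_integral_dominatingExtension {Ω : Set (EuclideanSpace ℝ (Fin d))}
    {μ₁ μ₂ : Measure (EuclideanSpace ℝ (Fin d))} [IsLocallyFiniteMeasure μ₁]
    [IsLocallyFiniteMeasure μ₂] (h : ∀ A, MeasurableSet A → A ⊆ Ωᶜ → μ₁ A ≤ μ₂ A)
    (hΩ : MeasurableSet Ω) {r : ℝ} (hr : 0 < r) (hΩr : Ω ⊆ Metric.closedBall 0 r)
    {φ : EuclideanSpace ℝ (Fin d) → ℝ} (hφ : ContinuousOn φ (Metric.closedBall 0 (r + 1))) :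
    (∫ x in Metric.closedBall 0 (r + 1), φ x ∂μ₂) - ∫ x in Metric.closedBall 0 (r + 1), φ x ∂μ₁ ≤
      (∫ x, dominatingExtension r φ x ∂μ₂) - ∫ x, dominatingExtension r φ x ∂μ₁ := by
  set B : Set (EuclideanSpace ℝ (Fin d)) := Metric.closedBall 0 (r + 1) with hB
  have hBm : MeasurableSet B := Metric.isClosed_closedBall.measurableSet
  have hiF : ∀ μ : Measure (EuclideanSpace ℝ (Fin d)), IsLocallyFiniteMeasure μ →
      Integrable (dominatingExtension r φ) μ := fun μ _ =>
    (continuous_dominatingExtension hr hφ).integrable_of_hasCompactSupport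
      (hasCompactSupport_dominatingExtension r φ)
  have hiφ : ∀ μ : Measure (EuclideanSpace ℝ (Fin d)), IsLocallyFiniteMeasure μ →
      Integrable (B.indicator φ) μ := fun μ _ =>
    (integrable_indicator_iff hBm).2 (hφ.integrableOn_compact (isCompact_closedBall _ _))
  have hsub : ∀ μ : Measure (EuclideanSpace ℝ (Fin d)), IsLocallyFiniteMeasure μ →
      ∫ x, (dominatingExtension r φ x - B.indicator φ x) ∂μ =
        (∫ x, dominatingExtension r φ x ∂μ) - ∫ x in B, φ x ∂μ := fun μ hμ => by
    rw [integral_sub (hiF μ hμ) (hiφ μ hμ), integral_indicator hBm]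
  -- The gap between the extension and `φ` on `B` is nonnegative and vanishes on `Ω`, so only the
  -- region where the measures are ordered matters.
  have hmain := integral_le_integral_of_restrict_compl_le h hΩ
    (G := fun x => dominatingExtension r φ x - B.indicator φ x)
    (fun x => sub_nonneg.2 (le_dominatingExtension hr φ x))
    (fun x hx => by
      have hx' : ‖x‖ ≤ r := mem_closedBall_zero_iff.1 (hΩr hx)
      rw [dominatingExtension_eq hr φ hx', Set.indicator_of_mem, sub_self]
      rw [hB, mem_closedBall_zero_iff]
      linarith)
    ((hiF μ₂ inferInstance).sub (hiφ μ₂ inferInstance))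
  rw [hsub μ₁ inferInstance, hsub μ₂ inferInstance] at hmain
  linarith

/-- Every Fourier transform of `ν` bounds the local dual norm of `ν`. -/
lemma exists_hNegNormOn_le (hd : 1 ≤ d) {s : ℝ} (hs : 0 < s) (hs1 : s < 1)
    {Ω : Set (EuclideanSpace ℝ (Fin d))} (hΩ : IsCompact Ω) {r : ℝ} (hr : 0 < r)
    (hΩr : Ω ⊆ Metric.closedBall 0 r) :
    ∃ C : ℝ≥0∞, C ≠ ∞ ∧ ∀ ν : SignedRadonMeasure d, (ν.NonnegOutside Ω ∨ ν.NonposOutside Ω) →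
      ∀ w, ν.IsFourierTransform w →
        hNegNormOn s (Metric.closedBall 0 (r + 1)) (ν.restrict (Metric.closedBall 0 (r + 1))) ≤
          C * (∫⁻ ξ, ‖w ξ‖ₑ ^ 2 * (1 + ‖ξ‖ₑ ^ 2) ^ (-s)) ^ (1 / 2 : ℝ) := by
  obtain ⟨C₁, hC₁, hdual⟩ := exists_enorm_integral_le hd hs hs1
  obtain ⟨C₂, hC₂, hext⟩ := exists_sobolevSq_dominatingExtension_le hd hs hs1 hr
  refine ⟨(C₁ * C₂) ^ (1 / 2 : ℝ),
    ENNReal.rpow_ne_top_of_nonneg (by norm_num) (ENNReal.mul_ne_top hC₁ hC₂),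
    fun ν hν w hw => ?_⟩
  set B : Set (EuclideanSpace ℝ (Fin d)) := Metric.closedBall 0 (r + 1) with hB
  have hBm : MeasurableSet B := Metric.isClosed_closedBall.measurableSet
  refine iSup₂_le fun φ hφ => ENNReal.div_le_of_le_mul ?_
  -- Stated for `ψ` so as to serve both `φ` and `-φ`.
  have hbound : ∀ ψ, ContinuousOn ψ B → hNormOn s B ψ = hNormOn s B φ →
      ‖ν.integral (dominatingExtension r ψ)‖ₑ ≤ (C₁ * C₂) ^ (1 / 2 : ℝ) *
        (∫⁻ ξ, ‖w ξ‖ₑ ^ 2 * (1 + ‖ξ‖ₑ ^ 2) ^ (-s)) ^ (1 / 2 : ℝ) * hNormOn s B φ := by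
    intro ψ hψ hψφ
    refine (hdual ν w hw _ (continuous_dominatingExtension hr hψ)
      (hasCompactSupport_dominatingExtension r ψ)).trans ?_
    rw [mul_right_comm]
    gcongr
    calc (C₁ * sobolevSq s (dominatingExtension r ψ)) ^ (1 / 2 : ℝ)
        ≤ (C₁ * (C₂ * hNormOn s B ψ ^ 2)) ^ (1 / 2 : ℝ) := by
          gcongr
          exact hext ψ hψ
      _ = (C₁ * C₂) ^ (1 / 2 : ℝ) * hNormOn s B φ := by
          rw [← mul_assoc, ENNReal.mul_rpow_of_nonneg _ _ (by norm_num), hψφ,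
            ← ENNReal.rpow_natCast, ← ENNReal.rpow_mul]
          norm_num
  have hint : ((ν.restrict B).restrict B).integral φ =
      (∫ x in B, φ x ∂ν.pos) - ∫ x in B, φ x ∂ν.neg := by
    simp only [SignedRadonMeasure.integral, SignedRadonMeasure.restrict,
      Measure.restrict_restrict hBm, Set.inter_self]
  rw [hint]
  rcases hν with hν | hν
  · refine le_trans ?_ (hbound φ hφ rfl)
    rw [Real.enorm_eq_ofReal_abs]
    refine ENNReal.ofReal_le_ofReal (le_trans ?_ (le_abs_self _))
    exact setIntegral_sub_le_integral_dominatingExtension hν hΩ.measurableSet hr hΩr hφ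
  -- Here `ν.pos ≤ ν.neg` off `Ω`: the parts exchange roles, and the sign of `-φ` restores `∫_B φ
  -- dν` on the left.
  · refine le_trans ?_ (hbound (-φ) hφ.neg (hNormOn_neg s B φ))
    rw [Real.enorm_eq_ofReal_abs]
    refine ENNReal.ofReal_le_ofReal (le_trans ?_ (neg_le_abs _))
    have h := setIntegral_sub_le_integral_dominatingExtension hν hΩ.measurableSet hr hΩr hφ.neg
    simp only [Pi.neg_apply, integral_neg] at h
    rw [SignedRadonMeasure.integral]
    linarith

/-- The weights compare pointwise, also at `ξ = 0`, where the homogeneous one is `∞`. -/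
lemma lintegral_inhomogeneous_le_homogeneous {s : ℝ} (hs : 0 < s)
    (w : EuclideanSpace ℝ (Fin d) → ℂ) :
    ∫⁻ ξ, ‖w ξ‖ₑ ^ 2 * (1 + ‖ξ‖ₑ ^ 2) ^ (-s) ≤ ∫⁻ ξ, ‖w ξ‖ₑ ^ 2 * ‖ξ‖ₑ ^ (-(2 * s)) := by
  refine lintegral_mono fun ξ => ?_
  gcongr
  rw [ENNReal.rpow_neg, ENNReal.rpow_neg, ENNReal.inv_le_inv, ENNReal.rpow_mul]
  gcongr
  refine le_trans (le_of_eq ?_) (le_add_left le_rfl)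
  rw [← ENNReal.rpow_natCast]; norm_num

end RieszLocalization

end

open RieszLocalization in
theorem mainTheorem6 (d : ℕ) (hd : 1 ≤ d) (s : ℝ) (hs0 : 0 < s) (hs1 : s < 1)
    (Ω : Set (EuclideanSpace ℝ (Fin d))) (hΩ : IsCompact Ω) :
    ∃ Ω₁ : Set (EuclideanSpace ℝ (Fin d)), IsCompact Ω₁ ∧ Ω ⊆ Ω₁ ∧
      ∃ C : ℝ, 0 < C ∧
        ∀ ν : SignedRadonMeasure d, ν.MemHNeg s →
          (ν.NonnegOutside Ω ∨ ν.NonposOutside Ω) →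
            ENNReal.ofReal C * hNegNormOn s Ω₁ (ν.restrict Ω₁) ≤ ν.hNegNorm s ∧
            ENNReal.ofReal C * hNegNormOn s Ω₁ (ν.restrict Ω₁) ≤ ν.homogeneousHNegNorm s := by
  obtain ⟨r, hr, hΩr⟩ := hΩ.isBounded.subset_closedBall_lt 0 0
  obtain ⟨C, hC, hle⟩ := exists_hNegNormOn_le hd hs0 hs1 hΩ hr hΩr
  refine ⟨Metric.closedBall 0 (r + 1), isCompact_closedBall _ _,
    hΩr.trans (Metric.closedBall_subset_closedBall (by linarith)), (C.toReal + 1)⁻¹,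
    by positivity, fun ν _ hν => ?_⟩
  -- Adding `1` before inverting covers a vanishing `C`.
  have hc : ENNReal.ofReal (C.toReal + 1)⁻¹ * C ≤ 1 := by
    rw [← ENNReal.ofReal_toReal hC, ← ENNReal.ofReal_mul (by positivity),
      ENNReal.toReal_ofReal ENNReal.toReal_nonneg]
    refine ENNReal.ofReal_le_one.2 ?_
    rw [inv_mul_le_iff₀ (by positivity)]
    linarith
  have key : ∀ w, ν.IsFourierTransform w → ENNReal.ofReal (C.toReal + 1)⁻¹ *
      hNegNormOn s (Metric.closedBall 0 (r + 1)) (ν.restrict (Metric.closedBall 0 (r + 1))) ≤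
        (∫⁻ ξ, ‖w ξ‖ₑ ^ 2 * (1 + ‖ξ‖ₑ ^ 2) ^ (-s)) ^ (1 / 2 : ℝ) := fun w hw => by
    refine (mul_le_mul_right (hle ν hν w hw) _).trans ?_
    rw [← mul_assoc]
    exact mul_le_of_le_one_left (by simp) hc
  -- Both norms are infima over admissible Fourier transforms, so a bound for each `w` suffices.
  refine ⟨le_iInf₂ key, le_iInf₂ fun w hw => (key w hw).trans ?_⟩
  exact ENNReal.rpow_le_rpow (lintegral_inhomogeneous_le_homogeneous hs0 w) (by norm_num)
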